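/- Let $(M_p)_{p\in\mathbb N_0}$ be a sequence of positive numbers with $M_0=1$ such that - (M.1) $M_p^2\le M_{p-1}M_{p+1}$ for all $p\ge 1$; - (M.2) there are $A,H>0$ with $M_p\le A H^p\min_{0\le q\le p}M_qM_{p-q}$ for all $p\ge 0$; - (M.3)'' there are $C,L>0$ with $p^{p/2}\le C L^pM_p$ for all $p\ge 0$. Put $M(\rho)=\sup_{p\in\mathbb N_0}\log(\rho^p/M_p)$ for $\rho>0$ and $M(0)=0$. For $m>0$ let $\mathcal S^{M_p,m}(\mathbb R^d)$ be the space of smooth $\varphi:\mathbb R^d\to\mathbb C$ with $$\|\varphi\|_m=\sup_{\alpha,\beta\in\mathbb N_0^d}\frac{m^{|\alpha|+|\beta|}}{M_{|\alpha|}M_{|\beta|}}\Big\|\prod_{i=1}^d(1+x_i^2)^{\beta_i/2}\,\varphi^{(\alpha)}(x)\Big\|_{L^\infty}<\infty,$$ let $\mathcal S^{\{M_p\}}(\mathbb R^d)=\bigcup_{m>0}\mathcal S^{M_p,m}(\mathbb R^d)$ with the locally convex inductive limit topology of these normed spaces, and let $\mathcal S^{\{M_p\}}{}'(\mathbb R^d)$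 be its topological dual. For $n\in\mathbb N_0$ and $x\in\mathbb R$ let $$\mathcal H_n(x)=(-1)^n\pi^{-1/4}2^{-n/2}(n!)^{-1/2}e^{x^2/2}\frac{d^n}{dx^n}e^{-x^2},$$ and for $n\in\mathbb N_0^d$, $x\in\mathbb R^d$ let $\mathcal H_n(x)=\mathcal H_{n_1}(x_1)\cdots\mathcal H_{n_d}(x_d)$. Put $a_n(\varphi)=\int_{\mathbb R^d}\varphi(x)\mathcal H_n(x)\,dx$ for $\varphi\in\mathcal S^{\{M_p\}}(\mathbb R^d)$. Then every $\mathcal H_n$, $n\in\mathbb N_0^d$, belongs to $\mathcal S^{\{M_p\}}(\mathbb R^d)$; for $f\in\mathcal S^{\{M_p\}}{}'(\mathbb R^d)$ put $a_n(f)=\langle f,\mathcal H_n\rangle$. Moreover: 1. If $f\in\mathcal S^{\{M_p\}}{}'(\mathbb R^d)$, then for every $\theta=(\theta_1,\dots,\theta_d)\in(0,\infty)^d$ there is a constant $C>0$ such that $$|a_n(f)|\le C\exp\Big[\sum_{k=1}^dM(\theta_k\sqrt{n_k})\Big]\quad\text{for all } n\in\mathbb N_0^d,$$ and $$\langle f,\varphi\rangle=\sum_{n\in\mathbb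 N_0^d}a_n(f)\,a_n(\varphi)\quad\text{for all }\varphi\in\mathcal S^{\{M_p\}}(\mathbb R^d),$$ where the series converges unconditionally. 2. Conversely, let $(b_n)_{n\in\mathbb N_0^d}$ be a sequence of complex numbers such that for every $\theta\in(0,\infty)^d$ there is $C>0$ with $|b_n|\le C\exp\big[\sum_{k=1}^dM(\theta_k\sqrt{n_k})\big]$ for all $n$. Then there is a unique $f\in\mathcal S^{\{M_p\}}{}'(\mathbb R^d)$ with $a_n(f)=b_n$ for all $n$, and for it $\langle f,\varphi\rangle=\sum_{n\in\mathbb N_0^d}a_n(f)a_n(\varphi)$ for all $\varphi\in\mathcal S^{\{M_p\}}(\mathbb R^d)$, the series again converging unconditionally. -/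

import Mathlib

open scoped ContDiff

noncomputable section

namespace GelfandShilov

/-- A sequence `(M_p)` of positive real numbers with `M_0 = 1`. -/
structure WeightSequence where
  toFun : ℕ → ℝ
  pos' : ∀ p, 0 < toFun p
  zero' : toFun 0 = 1

instance : CoeFun WeightSequence (fun _ => ℕ → ℝ) := ⟨WeightSequence.toFun⟩

/-- (M.1), logarithmic convexity: `M_p ^ 2 ≤ M_{p-1} M_{p+1}` for `p ≥ 1`. -/
def WeightSequence.LogConvex (M : WeightSequence) : Prop :=
  ∀ p : ℕ, M (p + 1) ^ 2 ≤ M p * M (p + 2)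

/-- (M.2), separativity (stability under ultradifferential operators). -/
def WeightSequence.Separative (M : WeightSequence) : Prop :=
  ∃ A H : ℝ, 0 < A ∧ 0 < H ∧ ∀ p q : ℕ, q ≤ p → M p ≤ A * H ^ p * (M q * M (p - q))

/-- (M.3)'', non-triviality: `p ^ (p / 2) ≤ C L ^ p M_p`. -/
def WeightSequence.NonTrivial (M : WeightSequence) : Prop :=
  ∃ C L : ℝ, 0 < C ∧ 0 < L ∧ ∀ p : ℕ, (p : ℝ) ^ ((p : ℝ) / 2) ≤ C * L ^ p * M p

/-- The associated function `M(ρ) = sup_p log (ρ ^ p / M_p)`. At `ρ = 0` the convention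
`Real.log 0 = 0` makes the value `0`, which is `log (0 ^ 0 / M_0)`. -/
def WeightSequence.assoc (M : WeightSequence) (ρ : ℝ) : ℝ :=
  ⨆ p : ℕ, Real.log (ρ ^ p / M p)

/-- `∂φ/∂x_i`. -/
def partialD {d : ℕ} (i : Fin d) (φ : EuclideanSpace ℝ (Fin d) → ℂ) :
    EuclideanSpace ℝ (Fin d) → ℂ :=
  fun x => fderiv ℝ φ x (EuclideanSpace.single i 1)

/-- The mixed derivative `φ^(α) = (∂/∂x_1)^(α_1) ⋯ (∂/∂x_d)^(α_d) φ`. -/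
def mixedD {d : ℕ} (α : Fin d → ℕ) (φ : EuclideanSpace ℝ (Fin d) → ℂ) :
    EuclideanSpace ℝ (Fin d) → ℂ :=
  (List.finRange d).foldr (fun i g => (partialD i)^[α i] g) φ

/-- `m^(|α|+|β|) / (M_|α| M_|β|) · |(1+x²)^(β/2) φ^(α)(x)|`, where
`(1+x²)^(β/2) = ∏ i, (1+x_i²)^(β_i/2)`. -/
def weightedTerm (M : WeightSequence) {d : ℕ} (m : ℝ) (φ : EuclideanSpace ℝ (Fin d) → ℂ)
    (q : (Fin d → ℕ) × (Fin d → ℕ) × EuclideanSpace ℝ (Fin d)) : ℝ :=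
  m ^ ((∑ i, q.1 i) + ∑ i, q.2.1 i) / (M (∑ i, q.1 i) * M (∑ i, q.2.1 i)) *
    ((∏ i, (1 + q.2.2 i ^ 2) ^ ((q.2.1 i : ℝ) / 2)) * ‖mixedD q.1 φ q.2.2‖)

section Calculus

variable {d : ℕ}

theorem contDiff_partialD (i : Fin d) {φ : EuclideanSpace ℝ (Fin d) → ℂ}
    (hφ : ContDiff ℝ ∞ φ) : ContDiff ℝ ∞ (partialD i φ) :=
  (hφ.fderiv_right (m := ∞) (by simp)).clm_apply contDiff_const

theorem contDiff_iterate_partialD (i : Fin d) (k : ℕ) {φ : EuclideanSpace ℝ (Fin d) → ℂ}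
    (hφ : ContDiff ℝ ∞ φ) : ContDiff ℝ ∞ ((partialD i)^[k] φ) := by
  induction k with
  | zero => exact hφ
  | succ k ih => rw [Function.iterate_succ_apply']; exact contDiff_partialD i ih

theorem partialD_linear (i : Fin d) (c : ℂ) {φ ψ : EuclideanSpace ℝ (Fin d) → ℂ}
    (hφ : ContDiff ℝ ∞ φ) (hψ : ContDiff ℝ ∞ ψ) :
    partialD i (c • φ + ψ) = c • partialD i φ + partialD i ψ := by
  have h1 : Differentiable ℝ φ := hφ.differentiable (by simp)
  have h2 : Differentiable ℝ ψ := hψ.differentiable (by simp)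
  funext x
  simp only [partialD, Pi.add_apply, Pi.smul_apply]
  rw [fderiv_add ((h1 x).const_smul c) (h2 x), fderiv_const_smul (h1 x)]
  rfl

theorem iterate_partialD_linear (i : Fin d) (k : ℕ) (c : ℂ)
    {φ ψ : EuclideanSpace ℝ (Fin d) → ℂ} (hφ : ContDiff ℝ ∞ φ) (hψ : ContDiff ℝ ∞ ψ) :
    (partialD i)^[k] (c • φ + ψ) = c • (partialD i)^[k] φ + (partialD i)^[k] ψ := by
  induction k with
  | zero => rfl
  | succ k ih =>
    simp only [Function.iterate_succ_apply']
    rw [ih, partialD_linear i c (contDiff_iterate_partialD i k hφ)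
      (contDiff_iterate_partialD i k hψ)]

theorem foldr_partialD (α : Fin d → ℕ) (c : ℂ) {φ ψ : EuclideanSpace ℝ (Fin d) → ℂ}
    (hφ : ContDiff ℝ ∞ φ) (hψ : ContDiff ℝ ∞ ψ) (l : List (Fin d)) :
    ContDiff ℝ ∞ (l.foldr (fun i g => (partialD i)^[α i] g) φ) ∧
    ContDiff ℝ ∞ (l.foldr (fun i g => (partialD i)^[α i] g) ψ) ∧
    l.foldr (fun i g => (partialD i)^[α i] g) (c • φ + ψ) =
      c • l.foldr (fun i g => (partialD i)^[α i] g) φ +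
        l.foldr (fun i g => (partialD i)^[α i] g) ψ := by
  induction l with
  | nil => exact ⟨hφ, hψ, rfl⟩
  | cons i l ih =>
    obtain ⟨h1, h2, h3⟩ := ih
    simp only [List.foldr_cons]
    refine ⟨contDiff_iterate_partialD _ _ h1, contDiff_iterate_partialD _ _ h2, ?_⟩
    rw [h3, iterate_partialD_linear _ _ _ h1 h2]

theorem mixedD_linear (α : Fin d → ℕ) (c : ℂ) {φ ψ : EuclideanSpace ℝ (Fin d) → ℂ}
    (hφ : ContDiff ℝ ∞ φ) (hψ : ContDiff ℝ ∞ ψ) :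
    mixedD α (c • φ + ψ) = c • mixedD α φ + mixedD α ψ :=
  (foldr_partialD α c hφ hψ _).2.2

theorem mixedD_zero (α : Fin d → ℕ) :
    mixedD α (0 : EuclideanSpace ℝ (Fin d) → ℂ) = 0 := by
  have h := mixedD_linear α (1 : ℂ) (φ := (0 : EuclideanSpace ℝ (Fin d) → ℂ))
    (ψ := (0 : EuclideanSpace ℝ (Fin d) → ℂ)) contDiff_const contDiff_const
  simpa using h

theorem mixedD_add (α : Fin d → ℕ) {φ ψ : EuclideanSpace ℝ (Fin d) → ℂ}
    (hφ : ContDiff ℝ ∞ φ) (hψ : ContDiff ℝ ∞ ψ) :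
    mixedD α (φ + ψ) = mixedD α φ + mixedD α ψ := by
  simpa using mixedD_linear α (1 : ℂ) hφ hψ

theorem mixedD_smul (α : Fin d → ℕ) (c : ℂ) {φ : EuclideanSpace ℝ (Fin d) → ℂ}
    (hφ : ContDiff ℝ ∞ φ) : mixedD α (c • φ) = c • mixedD α φ := by
  have h := mixedD_linear α c hφ (ψ := (0 : EuclideanSpace ℝ (Fin d) → ℂ)) contDiff_const
  simpa [mixedD_zero] using h

end Calculus

section Terms

variable (M : WeightSequence) {d : ℕ}

theorem weight_nonneg {m : ℝ} (hm : 0 < m) (a b : ℕ) : 0 ≤ m ^ (a + b) / (M a * M b) :=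
  div_nonneg (pow_nonneg hm.le _) (mul_pos (M.pos' _) (M.pos' _)).le

theorem prod_nonneg' (β : Fin d → ℕ) (x : EuclideanSpace ℝ (Fin d)) :
    0 ≤ ∏ i, (1 + x i ^ 2) ^ ((β i : ℝ) / 2) :=
  Finset.prod_nonneg fun _ _ => Real.rpow_nonneg (by positivity) _

theorem weightedTerm_nonneg {m : ℝ} (hm : 0 < m) (φ : EuclideanSpace ℝ (Fin d) → ℂ)
    (q : (Fin d → ℕ) × (Fin d → ℕ) × EuclideanSpace ℝ (Fin d)) :
    0 ≤ weightedTerm M m φ q :=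
  mul_nonneg (weight_nonneg M hm _ _) (mul_nonneg (prod_nonneg' _ _) (norm_nonneg _))

theorem weightedTerm_add {m : ℝ} (hm : 0 < m) {φ ψ : EuclideanSpace ℝ (Fin d) → ℂ}
    (hφ : ContDiff ℝ ∞ φ) (hψ : ContDiff ℝ ∞ ψ)
    (q : (Fin d → ℕ) × (Fin d → ℕ) × EuclideanSpace ℝ (Fin d)) :
    weightedTerm M m (φ + ψ) q ≤ weightedTerm M m φ q + weightedTerm M m ψ q := by
  simp only [weightedTerm]
  rw [mixedD_add _ hφ hψ, ← mul_add, ← mul_add]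
  exact mul_le_mul_of_nonneg_left
    (mul_le_mul_of_nonneg_left (norm_add_le _ _) (prod_nonneg' _ _)) (weight_nonneg M hm _ _)

theorem weightedTerm_smul (m : ℝ) (c : ℂ) {φ : EuclideanSpace ℝ (Fin d) → ℂ}
    (hφ : ContDiff ℝ ∞ φ)
    (q : (Fin d → ℕ) × (Fin d → ℕ) × EuclideanSpace ℝ (Fin d)) :
    weightedTerm M m (c • φ) q = ‖c‖ * weightedTerm M m φ q := by
  simp only [weightedTerm]
  rw [mixedD_smul _ _ hφ, Pi.smul_apply, norm_smul]
  ring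

theorem weightedTerm_zero (m : ℝ)
    (q : (Fin d → ℕ) × (Fin d → ℕ) × EuclideanSpace ℝ (Fin d)) :
    weightedTerm M m (0 : EuclideanSpace ℝ (Fin d) → ℂ) q = 0 := by
  simp [weightedTerm, mixedD_zero]

theorem weightedTerm_mono {m m' : ℝ} (hm : 0 < m) (h : m ≤ m')
    (φ : EuclideanSpace ℝ (Fin d) → ℂ)
    (q : (Fin d → ℕ) × (Fin d → ℕ) × EuclideanSpace ℝ (Fin d)) :
    weightedTerm M m φ q ≤ weightedTerm M m' φ q := by
  refine mul_le_mul_of_nonneg_right ?_ (mul_nonneg (prod_nonneg' _ _) (norm_nonneg _))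
  exact div_le_div_of_nonneg_right (pow_le_pow_left₀ hm.le h _)
    (mul_pos (M.pos' _) (M.pos' _)).le

end Terms

/-- The functions of `S^{M_p,m}(ℝ^d)`: smooth functions with
`sup_{α,β,x} m^(|α|+|β|) / (M_|α| M_|β|) · |(1+x²)^(β/2) φ^(α)(x)| < ∞`. -/
def stepSubmodule (M : WeightSequence) (d : ℕ) (m : {r : ℝ // 0 < r}) :
    Submodule ℂ (EuclideanSpace ℝ (Fin d) → ℂ) where
  carrier := {φ | ContDiff ℝ ∞ φ ∧ BddAbove (Set.range (weightedTerm M m.1 φ))}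
  add_mem' := by
    rintro φ ψ ⟨hφ, A, hA⟩ ⟨hψ, B, hB⟩
    refine ⟨hφ.add hψ, A + B, ?_⟩
    rintro _ ⟨q, rfl⟩
    exact (weightedTerm_add M m.2 hφ hψ q).trans (add_le_add (hA ⟨q, rfl⟩) (hB ⟨q, rfl⟩))
  zero_mem' := by
    refine ⟨contDiff_const, 0, ?_⟩
    rintro _ ⟨q, rfl⟩
    exact (weightedTerm_zero M m.1 q).le
  smul_mem' := by
    rintro c φ ⟨hφ, A, hA⟩
    refine ⟨hφ.const_smul c, ‖c‖ * A, ?_⟩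
    rintro _ ⟨q, rfl⟩
    rw [weightedTerm_smul M m.1 c hφ q]
    exact mul_le_mul_of_nonneg_left (hA ⟨q, rfl⟩) (norm_nonneg c)

theorem stepSubmodule_anti (M : WeightSequence) (d : ℕ) {m m' : {r : ℝ // 0 < r}}
    (h : m.1 ≤ m'.1) : stepSubmodule M d m' ≤ stepSubmodule M d m := by
  rintro φ ⟨hφ, A, hA⟩
  refine ⟨hφ, A, ?_⟩
  rintro _ ⟨q, rfl⟩
  exact (weightedTerm_mono M m.2 h φ q).trans (hA ⟨q, rfl⟩)

/-- The space `S^{M_p,m}(ℝ^d)`, a normed space (see below). -/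
def StepSpace (M : WeightSequence) (d : ℕ) (m : {r : ℝ // 0 < r}) : Type :=
  ↥(stepSubmodule M d m)

namespace StepSpace

variable {M : WeightSequence} {d : ℕ} {m : {r : ℝ // 0 < r}}

instance : AddCommGroup (StepSpace M d m) := inferInstanceAs (AddCommGroup ↥(stepSubmodule M d m))

instance : Module ℂ (StepSpace M d m) := inferInstanceAs (Module ℂ ↥(stepSubmodule M d m))

/-- `‖φ‖ = sup_{α,β} m^(|α|+|β|) / (M_|α| M_|β|) · ‖(1+x²)^(β/2) φ^(α)‖_∞`. -/
instance : Norm (StepSpace M d m) := ⟨fun φ => ⨆ q, weightedTerm M m.1 φ.1 q⟩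

theorem norm_def (φ : StepSpace M d m) : ‖φ‖ = ⨆ q, weightedTerm M m.1 φ.1 q := rfl

theorem le_norm (φ : StepSpace M d m)
    (q : (Fin d → ℕ) × (Fin d → ℕ) × EuclideanSpace ℝ (Fin d)) :
    weightedTerm M m.1 φ.1 q ≤ ‖φ‖ := le_ciSup φ.2.2 q

theorem normCore : NormedSpace.Core ℂ (StepSpace M d m) where
  norm_nonneg φ := Real.iSup_nonneg fun q => weightedTerm_nonneg M m.2 φ.1 q
  norm_smul c φ := by
    rw [norm_def, norm_def, Real.mul_iSup_of_nonneg (norm_nonneg c)]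
    exact iSup_congr fun q => weightedTerm_smul M m.1 c φ.2.1 q
  norm_triangle φ ψ := ciSup_le fun q =>
    (weightedTerm_add M m.2 φ.2.1 ψ.2.1 q).trans (add_le_add (le_norm φ q) (le_norm ψ q))
  norm_eq_zero_iff φ := by
    constructor
    · intro h
      refine Subtype.ext (funext fun x => ?_)
      have h0 := le_norm φ (0, 0, x)
      rw [h] at h0
      have h1 : mixedD (0 : Fin d → ℕ) φ.1 = φ.1 := by
        simp only [mixedD, Pi.zero_apply, Function.iterate_zero, id]
        induction List.finRange d with
        | nil => rfl
        | cons i l ih => exact ih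
      simp only [weightedTerm, h1] at h0
      have h2 : φ.1 x = 0 := by simpa [M.zero'] using h0
      exact h2
    · rintro rfl
      rw [norm_def]
      have : ∀ q, weightedTerm M m.1 (0 : StepSpace M d m).1 q = 0 :=
        fun q => weightedTerm_zero M m.1 q
      simp [this]

instance : NormedAddCommGroup (StepSpace M d m) := NormedAddCommGroup.ofCore normCore

instance : NormedSpace ℂ (StepSpace M d m) := NormedSpace.ofCore normCore

end StepSpace

/-- The functions of `S^{M_p}(ℝ^d)` (Roumieu type): the union of the `S^{M_p,m}(ℝ^d)`, `m > 0`. -/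
def spaceSubmodule (M : WeightSequence) (d : ℕ) :
    Submodule ℂ (EuclideanSpace ℝ (Fin d) → ℂ) where
  carrier := {φ | ∃ m, φ ∈ stepSubmodule M d m}
  add_mem' := by
    rintro φ ψ ⟨m, hm⟩ ⟨m', hm'⟩
    refine ⟨⟨min m.1 m'.1, lt_min m.2 m'.2⟩, add_mem ?_ ?_⟩
    · exact stepSubmodule_anti M d (min_le_left m.1 m'.1) hm
    · exact stepSubmodule_anti M d (min_le_right m.1 m'.1) hm'
  zero_mem' := ⟨⟨1, one_pos⟩, zero_mem _⟩
  smul_mem' := by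
    rintro c φ ⟨m, hm⟩
    exact ⟨m, Submodule.smul_mem _ c hm⟩

/-- The generalized Gelfand-Shilov space of Roumieu type on `ℝ^d`. -/
def Space (M : WeightSequence) (d : ℕ) : Type := ↥(spaceSubmodule M d)

namespace Space

variable {M : WeightSequence} {d : ℕ}

instance : AddCommGroup (Space M d) := inferInstanceAs (AddCommGroup ↥(spaceSubmodule M d))

instance : Module ℂ (Space M d) := inferInstanceAs (Module ℂ ↥(spaceSubmodule M d))

instance : CoeFun (Space M d) (fun _ => EuclideanSpace ℝ (Fin d) → ℂ) := ⟨Subtype.val⟩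

/-- The inclusion of `S^{M_p,m}(ℝ^d)` into the Gelfand-Shilov space. -/
def ofStep (m : {r : ℝ // 0 < r}) : StepSpace M d m →ₗ[ℂ] Space M d where
  toFun φ := ⟨φ.1, m, φ.2⟩
  map_add' _ _ := rfl
  map_smul' _ _ := rfl

/-- The locally convex inductive limit topology: the finest locally convex vector space topology
for which all the inclusions of the spaces `S^{M_p,m}(ℝ^d)` are continuous. -/
instance : TopologicalSpace (Space M d) :=
  sInf {t : TopologicalSpace (Space M d) |
    (∀ m : {r : ℝ // 0 < r}, @Continuous (StepSpace M d m) (Space M d) inferInstance t (ofStep m)) ∧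
    @IsTopologicalAddGroup (Space M d) t _ ∧
    @ContinuousSMul ℂ (Space M d) _ _ t ∧
    @LocallyConvexSpace ℝ (Space M d) _ _ _ _ t}

instance : IsTopologicalAddGroup (Space M d) :=
  topologicalAddGroup_sInf fun _ ⟨_, ht, _, _⟩ => ht

instance : ContinuousSMul ℂ (Space M d) :=
  continuousSMul_sInf fun _ ⟨_, _, ht, _⟩ => ht

instance : LocallyConvexSpace ℝ (Space M d) :=
  .sInf fun _ ⟨_, _, _, ht⟩ => ht

end Space

/-- The one-dimensional Hermite functions
`H_n(x) = (-1)^n π^(-1/4) 2^(-n/2) (n!)^(-1/2) e^(x²/2) (d/dx)^n e^(-x²)`. -/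
def hermite1 (n : ℕ) (x : ℝ) : ℝ :=
  (-1) ^ n * Real.pi ^ (-(1 / 4 : ℝ)) * 2 ^ (-(n : ℝ) / 2) * (n.factorial : ℝ) ^ (-(1 / 2 : ℝ)) *
    Real.exp (x ^ 2 / 2) * iteratedDeriv n (fun t : ℝ => Real.exp (-t ^ 2)) x

/-- The Hermite functions on `ℝ^d`: `H_n(x) = H_{n_1}(x_1) ⋯ H_{n_d}(x_d)`. -/
def hermite {d : ℕ} (n : Fin d → ℕ) (x : EuclideanSpace ℝ (Fin d)) : ℂ :=
  ((∏ k, hermite1 (n k) (x k) : ℝ) : ℂ)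

/-- The Fourier-Hermite coefficients `a_n(φ) = ∫ φ(x) H_n(x) dx` of a test function. -/
def coeff {M : WeightSequence} {d : ℕ} (n : Fin d → ℕ) (φ : Space M d) : ℂ :=
  ∫ x : EuclideanSpace ℝ (Fin d), φ x * hermite n x

/-- Ultrafast growth: for every `θ ∈ ℝ^d_+` there is a constant `C` with
`|b_n| ≤ C exp (∑ k, M(θ_k √n_k))` for all `n`. -/
def UltrafastGrowth (M : WeightSequence) {d : ℕ} (b : (Fin d → ℕ) → ℂ) : Prop :=
  ∀ θ : Fin d → ℝ, (∀ k, 0 < θ k) → ∃ C : ℝ, 0 < C ∧ ∀ n : Fin d → ℕ,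
    ‖b n‖ ≤ C * Real.exp (∑ k, M.assoc (θ k * √(n k : ℝ)))

end GelfandShilov

end

/-!
Everything rests on two estimates for the weight `e(ρ) = exp (M.assoc ρ)`, the least `K` with
`ρ ^ p ≤ K * M p` for all `p`.

*Growth of the Hermite functions* (`exists_weightedTerm_hermite_le`): for every `θ > 0` there is a
step in which the norm of `hermite n` is at most `C * ∏ i, e (θ √n_i)`. Multiplication by `x_i` and
`∂/∂x_i` send a Hermite function to a combination of its two neighbours, with coefficients of size
`√n_i`. So `k` such operators cost at most a geometric factor times `√((n+k+1)!/n!)`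
(`wt_mul_norm_mixedD_hermite_le`), which is bounded by multiples of `√n ^ (k+1)` and
`√(k+1) ^ (k+1)`. The first is controlled by the definition of the associated function, the second
by (M.3)''. A uniform bound on the Hermite functions that is polynomial in `n` suffices as a start
(`hermite1_sq_le`).

*Decay of the coefficients* (`StepSpace.exists_norm_integral_le`): for every step there is a `θ > 0`
such that the coefficients of its elements are at most `C * ‖φ‖ * ∏ i, 1 / e (θ √n_i)`. The adjoint
of the creation operator is `x_i + ∂/∂x_i`, so the coefficient of `φ` of index `n + p` is, up to a
factor of size `∏ i, √n_i ^ p_i`, the coefficient of index `n` of the function obtained from `φ` by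
applying these operators `p` times (`two_mul_sqrt_mul_integral`). The bounds on that function are
controlled by induction on `p` (`GrowthBound.annihilation`): (M.1) and (M.3)'' together give
`q * M (q-1) ≤ c * M (q+1)`, which absorbs the commutators. An optimal choice of `p` gives the
claim.

By (M.2), a smaller `θ'` makes `∏ i, e (θ' √n_i) / e (θ √n_i)` summable over `n`
(`exists_summable_exp_assoc`). Therefore the Hermite expansion of a test function converges
absolutely in some step. Its sum is the function itself, because the Hermite functions are complete
(`eq_zero_of_integral_mul_hermite_eq_zero`), a fact which is applied to all derivatives
(`RapidDecay.hasSum_mixedD`). Applying a continuous functional to the expansion gives the first part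
of the theorem. For the second part, the functional `∑ n, b_n a_n(φ)` is bounded on every step by
the decay estimate, hence continuous for the inductive limit topology; orthonormality gives its
values on the Hermite functions, and the expansion gives uniqueness.
-/

open scoped ContDiff

noncomputable section

namespace GelfandShilov

/-! ### The weight sequence and its associated function -/

namespace WeightSequence

variable {M : WeightSequence}

theorem exists_sqrt_pow_le (hM3 : M.NonTrivial) :
    ∃ C L : ℝ, 1 ≤ C ∧ 1 ≤ L ∧ ∀ p : ℕ, √(p : ℝ) ^ p ≤ C * L ^ p * M p := by
  obtain ⟨C, L, hC, hL, h⟩ := hM3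
  refine ⟨max C 1, max L 1, le_max_right _ _, le_max_right _ _, fun p => ?_⟩
  have e : √(p : ℝ) ^ p = (p : ℝ) ^ ((p : ℝ) / 2) := by
    rw [Real.sqrt_eq_rpow, ← Real.rpow_natCast, ← Real.rpow_mul (by positivity)]
    congr 1; ring
  rw [e]
  refine (h p).trans ?_
  have := (M.pos' p).le
  gcongr
  · exact le_max_left _ _
  · exact le_max_left _ _

theorem exists_add_le (hM2 : M.Separative) :
    ∃ A H : ℝ, 1 ≤ A ∧ 1 ≤ H ∧ ∀ p q : ℕ, M (p + q) ≤ A * H ^ (p + q) * (M p * M q) := by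
  obtain ⟨A, H, hA, hH, h⟩ := hM2
  refine ⟨max A 1, max H 1, le_max_right _ _, le_max_right _ _, fun p q => ?_⟩
  have h1 := h (p + q) p (Nat.le_add_right _ _)
  rw [Nat.add_sub_cancel_left] at h1
  refine h1.trans ?_
  have := mul_pos (M.pos' p) (M.pos' q)
  gcongr
  · exact le_max_left _ _
  · exact le_max_left _ _

theorem LogConvex.monotone_ratio (hM1 : M.LogConvex) : Monotone fun p => M (p + 1) / M p := by
  refine monotone_nat_of_le_succ fun p => ?_
  rw [div_le_div_iff₀ (M.pos' _) (M.pos' _)]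
  nlinarith [hM1 p]

theorem LogConvex.mul_le_add (hM1 : M.LogConvex) (p q : ℕ) : M p * M q ≤ M (p + q) := by
  induction p with
  | zero => simp [M.zero']
  | succ p ih =>
    have h1 : M (p + 1) / M p ≤ M (p + q + 1) / M (p + q) :=
      hM1.monotone_ratio (Nat.le_add_right p q)
    have h2 : M (p + 1) = M (p + 1) / M p * M p := by field_simp [(M.pos' p).ne']
    have h3 : M (p + q + 1) = M (p + q + 1) / M (p + q) * M (p + q) := by
      field_simp [(M.pos' (p + q)).ne']
    rw [Nat.add_right_comm, h2, h3, mul_assoc]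
    have := M.pos' p
    have := M.pos' q
    have := M.pos' (p + q + 1)
    have := M.pos' (p + q)
    gcongr

theorem LogConvex.prod_le {ι : Type*} (hM1 : M.LogConvex) (s : Finset ι) (p : ι → ℕ) :
    ∏ i ∈ s, M (p i) ≤ M (∑ i ∈ s, p i) := by
  classical
  induction s using Finset.induction_on with
  | empty => simp [M.zero']
  | insert a s ha ih =>
    rw [Finset.prod_insert ha, Finset.sum_insert ha]
    exact (mul_le_mul_of_nonneg_left ih (M.pos' _).le).trans (hM1.mul_le_add _ _)

theorem LogConvex.le_ratio_pow (hM1 : M.LogConvex) (q : ℕ) :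
    ∀ p ≤ q + 1, M p ≤ (M (q + 1) / M q) ^ p := by
  intro p
  induction p with
  | zero => simp [M.zero']
  | succ p ih =>
    intro hp
    have h1 : M (p + 1) / M p ≤ M (q + 1) / M q := hM1.monotone_ratio (by omega)
    have h2 : M (p + 1) = M (p + 1) / M p * M p := by field_simp [(M.pos' p).ne']
    rw [h2, pow_succ']
    have := M.pos' p
    have := M.pos' q
    have := M.pos' (q + 1)
    exact mul_le_mul h1 (ih (by omega)) (M.pos' p).le (by positivity)

/-- The ratios `M_{q+1} / M_q` grow at least like `√q`: they are increasing, so the last of them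
dominates the geometric mean `M_{q+1} ^ (1 / (q+1))` of the first `q + 1`. -/
theorem exists_mul_le_add_two (hM1 : M.LogConvex) (hM3 : M.NonTrivial) :
    ∃ c : ℝ, 0 < c ∧ ∀ q : ℕ, ((q : ℝ) + 1) * M q ≤ c * M (q + 2) := by
  obtain ⟨C, L, hC, hL, h⟩ := exists_sqrt_pow_le hM3
  refine ⟨(C * L) ^ 2, by positivity, fun q => ?_⟩
  have h0 := M.pos' q
  have h1 := M.pos' (q + 1)
  have h2 := M.pos' (q + 2)
  have hr : 0 < M (q + 1) / M q := div_pos h1 h0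
  have key : √((q + 1 : ℕ) : ℝ) ≤ C * L * (M (q + 1) / M q) := by
    refine le_of_pow_le_pow_left₀ (Nat.succ_ne_zero q) (by positivity) ((h (q + 1)).trans ?_)
    rw [mul_pow, mul_pow]
    have := hM1.le_ratio_pow q (q + 1) le_rfl
    gcongr
    exact le_self_pow₀ hC (Nat.succ_ne_zero q)
  have h3 : (q : ℝ) + 1 ≤ (C * L) ^ 2 * (M (q + 1) / M q) ^ 2 := by
    rw [← mul_pow]
    have := pow_le_pow_left₀ (Real.sqrt_nonneg _) key 2
    rw [Real.sq_sqrt (by positivity)] at this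
    exact_mod_cast this
  calc ((q : ℝ) + 1) * M q ≤ (C * L) ^ 2 * (M (q + 1) / M q) ^ 2 * M q := by gcongr
    _ = (C * L) ^ 2 * (M (q + 1) ^ 2 / M q) := by field_simp
    _ ≤ (C * L) ^ 2 * M (q + 2) := by
      gcongr
      rw [div_le_iff₀ h0]
      linarith [hM1 q]

theorem exists_sum_le (hM2 : M.Separative) (d : ℕ) :
    ∃ A H : ℝ, 1 ≤ A ∧ 1 ≤ H ∧ ∀ p : Fin d → ℕ,
      M (∑ i, p i) ≤ A * H ^ (∑ i, p i) * ∏ i, M (p i) := by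
  obtain ⟨A, H, hA, hH, h⟩ := exists_add_le hM2
  refine ⟨A ^ d, H ^ d, one_le_pow₀ hA, one_le_pow₀ hH, fun p => ?_⟩
  have key : ∀ s : Finset (Fin d), M (∑ i ∈ s, p i) ≤
      A ^ s.card * (H ^ s.card) ^ (∑ i ∈ s, p i) * ∏ i ∈ s, M (p i) := by
    intro s
    induction s using Finset.induction_on with
    | empty => simp [M.zero']
    | insert a s ha ih =>
      rw [Finset.prod_insert ha, Finset.sum_insert ha, Finset.card_insert_of_notMem ha]
      have hp := M.pos' (p a)
      have hP : 0 < ∏ i ∈ s, M (p i) := Finset.prod_pos fun i _ => M.pos' (p i)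
      calc M (p a + ∑ i ∈ s, p i)
          ≤ A * H ^ (p a + ∑ i ∈ s, p i) * (M (p a) * M (∑ i ∈ s, p i)) := h _ _
        _ ≤ A * H ^ (p a + ∑ i ∈ s, p i) * (M (p a) *
            (A ^ s.card * (H ^ s.card) ^ (∑ i ∈ s, p i) * ∏ i ∈ s, M (p i))) := by gcongr
        _ = A ^ (s.card + 1) * (H ^ (p a + ∑ i ∈ s, p i) * (H ^ s.card) ^ (∑ i ∈ s, p i)) *
            (M (p a) * ∏ i ∈ s, M (p i)) := by ring
        _ ≤ A ^ (s.card + 1) * (H ^ (p a + ∑ i ∈ s, p i) *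
            (H ^ s.card) ^ (p a + ∑ i ∈ s, p i)) * (M (p a) * ∏ i ∈ s, M (p i)) := by
          gcongr
          · exact one_le_pow₀ hH
          · exact Nat.le_add_left _ _
        _ = _ := by rw [← mul_pow, ← pow_succ']
  simpa using key Finset.univ

theorem bddAbove_log (hM3 : M.NonTrivial) {ρ : ℝ} (hρ : 0 ≤ ρ) :
    BddAbove (Set.range fun p : ℕ => Real.log (ρ ^ p / M p)) := by
  obtain ⟨C, L, hC, hL, h⟩ := exists_sqrt_pow_le hM3
  set N := ⌈(L * ρ) ^ 2⌉₊
  have hK : ∀ p : ℕ, ρ ^ p / M p ≤ C * (1 + L * ρ) ^ N := by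
    intro p
    rw [div_le_iff₀ (M.pos' p)]
    have hb : 1 ≤ 1 + L * ρ := by nlinarith
    have hLp : 0 < L ^ p := by positivity
    have h1 : (L * ρ) ^ p ≤ (1 + L * ρ) ^ N * (C * L ^ p * M p) := by
      have hone : (1 : ℝ) ≤ (1 + L * ρ) ^ N := one_le_pow₀ hb
      rcases le_total N p with hNp | hNp
      · have h2 : L * ρ ≤ √(p : ℝ) := by
          refine Real.le_sqrt_of_sq_le ((Nat.le_ceil _).trans ?_)
          exact_mod_cast hNp
        calc (L * ρ) ^ p ≤ √(p : ℝ) ^ p := by gcongr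
          _ ≤ C * L ^ p * M p := h p
          _ ≤ _ := le_mul_of_one_le_left (by have := M.pos' p; positivity) hone
      · have h3 : (1 : ℝ) ≤ C * L ^ p * M p := by
          refine le_trans ?_ (h p)
          rcases Nat.eq_zero_or_pos p with rfl | hp
          · simp
          · refine one_le_pow₀ ?_
            rw [Real.one_le_sqrt]
            exact_mod_cast hp
        calc (L * ρ) ^ p ≤ (1 + L * ρ) ^ p := by gcongr; linarith
          _ ≤ (1 + L * ρ) ^ N := pow_le_pow_right₀ hb hNp
          _ ≤ _ := le_mul_of_one_le_right (by positivity) h3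
    rw [mul_pow] at h1
    have h4 : L ^ p * ρ ^ p ≤ L ^ p * (C * (1 + L * ρ) ^ N * M p) := by linarith
    exact le_of_mul_le_mul_left h4 hLp
  have h1K : 1 ≤ C * (1 + L * ρ) ^ N := by simpa [M.zero'] using hK 0
  refine ⟨Real.log (C * (1 + L * ρ) ^ N), ?_⟩
  rintro _ ⟨p, rfl⟩
  have h0 : 0 ≤ ρ ^ p / M p := div_nonneg (pow_nonneg hρ _) (M.pos' p).le
  rcases h0.eq_or_lt with h0 | h0
  · simp only [← h0, Real.log_zero]
    exact Real.log_nonneg h1K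
  · exact Real.log_le_log h0 (hK p)

theorem pow_le_mul_exp_assoc (hM3 : M.NonTrivial) {ρ : ℝ} (hρ : 0 ≤ ρ) (p : ℕ) :
    ρ ^ p ≤ M p * Real.exp (M.assoc ρ) := by
  have h0 : 0 ≤ ρ ^ p / M p := div_nonneg (pow_nonneg hρ _) (M.pos' p).le
  rw [mul_comm, ← div_le_iff₀ (M.pos' p)]
  rcases h0.eq_or_lt with h0 | h0
  · rw [← h0]; positivity
  · rw [← Real.log_le_iff_le_exp h0]
    exact le_ciSup (bddAbove_log hM3 hρ) p

theorem exp_assoc_le {ρ K : ℝ} (hρ : 0 ≤ ρ) (h : ∀ p : ℕ, ρ ^ p ≤ K * M p) :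
    Real.exp (M.assoc ρ) ≤ K := by
  have h1 : 1 ≤ K := by simpa [M.zero'] using h 0
  rw [← Real.le_log_iff_exp_le (by linarith)]
  refine ciSup_le fun p => ?_
  have h0 : 0 ≤ ρ ^ p / M p := div_nonneg (pow_nonneg hρ _) (M.pos' p).le
  rcases h0.eq_or_lt with h0 | h0
  · rw [← h0, Real.log_zero]
    exact Real.log_nonneg h1
  · exact Real.log_le_log h0 ((div_le_iff₀ (M.pos' p)).2 (h p))

theorem exp_assoc_mono (hM3 : M.NonTrivial) {ρ ρ' : ℝ} (hρ : 0 ≤ ρ) (h : ρ ≤ ρ') :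
    Real.exp (M.assoc ρ) ≤ Real.exp (M.assoc ρ') :=
  exp_assoc_le hρ fun p => by
    rw [mul_comm]
    exact (pow_le_pow_left₀ hρ h p).trans (pow_le_mul_exp_assoc hM3 (hρ.trans h) p)

/-- Up to a factor `2`, the supremum defining the associated function is attained. -/
theorem exists_exp_assoc_mul_le {ρ : ℝ} (hρ : 0 ≤ ρ) :
    ∃ p : ℕ, Real.exp (M.assoc ρ) * M p ≤ 2 * ρ ^ p := by
  by_contra! h
  have h1 : Real.exp (M.assoc ρ) ≤ Real.exp (M.assoc ρ) / 2 :=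
    exp_assoc_le hρ fun p => by linarith [h p]
  linarith [Real.exp_pos (M.assoc ρ)]

/-- By (M.2), enlarging the argument of the associated function by a constant factor gains any
power of the argument; the fourth power is what the summations over `n` need. -/
theorem exists_shift (hM2 : M.Separative) (hM3 : M.NonTrivial) :
    ∃ C H : ℝ, 1 ≤ C ∧ 1 ≤ H ∧ ∀ ρ : ℝ, 0 ≤ ρ →
      (1 + ρ ^ 4) * Real.exp (M.assoc ρ) ≤ C * Real.exp (M.assoc (H * ρ)) := by
  obtain ⟨A, H, hA, hH, h⟩ := exists_add_le hM2
  have h4 := M.pos' 4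
  refine ⟨1 + 2 * A * M 4, H, by nlinarith, hH, fun ρ hρ => ?_⟩
  have e1 : Real.exp (M.assoc ρ) ≤ Real.exp (M.assoc (H * ρ)) :=
    exp_assoc_mono hM3 hρ (by nlinarith)
  have e2 : ρ ^ 4 * Real.exp (M.assoc ρ) ≤ 2 * A * M 4 * Real.exp (M.assoc (H * ρ)) := by
    obtain ⟨p, hp⟩ := exists_exp_assoc_mul_le (M := M) hρ
    have hMp := M.pos' p
    have hHp : 0 < H ^ (p + 4) := by positivity
    refine le_of_mul_le_mul_left ?_ (mul_pos hHp hMp)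
    calc H ^ (p + 4) * M p * (ρ ^ 4 * Real.exp (M.assoc ρ))
        = H ^ (p + 4) * ρ ^ 4 * (Real.exp (M.assoc ρ) * M p) := by ring
      _ ≤ H ^ (p + 4) * ρ ^ 4 * (2 * ρ ^ p) := by gcongr
      _ = 2 * (H * ρ) ^ (p + 4) := by ring
      _ ≤ 2 * (M (p + 4) * Real.exp (M.assoc (H * ρ))) := by
        have := pow_le_mul_exp_assoc hM3 (ρ := H * ρ) (by positivity) (p + 4)
        gcongr
      _ ≤ 2 * (A * H ^ (p + 4) * (M p * M 4) * Real.exp (M.assoc (H * ρ))) := by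
        gcongr; exact h p 4
      _ = _ := by ring
  linarith

end WeightSequence

theorem summable_pi_prod {d : ℕ} {f : ℕ → ℝ} (hf0 : ∀ n, 0 ≤ f n) (hf : Summable f) :
    Summable fun n : Fin d → ℕ => ∏ i, f (n i) := by
  refine summable_of_sum_le (c := (∑' n, f n) ^ d)
    (fun n => Finset.prod_nonneg fun i _ => hf0 _) fun u => ?_
  set N := u.sup (fun n => ∑ i, n i) + 1 with hN
  have hu : u ⊆ Fintype.piFinset fun _ : Fin d => Finset.range N := by
    intro n hn
    rw [Fintype.mem_piFinset]
    intro i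
    have h1 : n i ≤ ∑ i, n i := Finset.single_le_sum (fun _ _ => Nat.zero_le _) (Finset.mem_univ i)
    have h2 : ∑ i, n i ≤ u.sup fun n => ∑ i, n i :=
      Finset.le_sup (f := fun n : Fin d → ℕ => ∑ i, n i) hn
    rw [Finset.mem_range]; omega
  calc ∑ n ∈ u, ∏ i, f (n i)
      ≤ ∑ n ∈ Fintype.piFinset fun _ : Fin d => Finset.range N, ∏ i, f (n i) :=
        Finset.sum_le_sum_of_subset_of_nonneg hu
          fun n _ _ => Finset.prod_nonneg fun i _ => hf0 _
    _ = ∏ _i : Fin d, ∑ k ∈ Finset.range N, f k := (Finset.prod_univ_sum _ _).symm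
    _ ≤ ∏ _i : Fin d, ∑' k, f k := by
        refine Finset.prod_le_prod (fun i _ => Finset.sum_nonneg fun _ _ => hf0 _) fun i _ => ?_
        exact hf.sum_le_tsum _ fun _ _ => hf0 _
    _ = _ := by simp

theorem exists_summable_exp_assoc {M : WeightSequence} (hM2 : M.Separative) (hM3 : M.NonTrivial)
    (d : ℕ) {θ : ℝ} (hθ : 0 < θ) : ∃ θ' : ℝ, 0 < θ' ∧ Summable fun n : Fin d → ℕ =>
      Real.exp (∑ i, M.assoc (θ' * √(n i))) * Real.exp (-∑ i, M.assoc (θ * √(n i))) := by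
  obtain ⟨C, H, hC, hH, h⟩ := WeightSequence.exists_shift hM2 hM3
  have hH0 : 0 < H := by linarith
  refine ⟨θ / H, by positivity, ?_⟩
  have hs : Summable fun n : ℕ => C / (1 + (θ / H) ^ 4 * (n : ℝ) ^ 2) := by
    rw [← summable_nat_add_iff 1]
    have h2 := (summable_nat_add_iff 1).2 ((Real.summable_nat_pow_inv (p := 2)).2 (by norm_num))
    refine Summable.of_nonneg_of_le (fun n => by positivity) (fun n => ?_)
      (h2.mul_left (C / (θ / H) ^ 4))
    rw [div_mul_eq_mul_div, div_le_div_iff₀ (by positivity) (by positivity), mul_assoc]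
    gcongr
    rw [inv_mul_eq_div, le_div_iff₀ (by positivity)]
    linarith
  refine Summable.of_nonneg_of_le (fun n => by positivity) (fun n => ?_)
    (summable_pi_prod (fun n => by positivity) hs)
  rw [← Real.exp_add, ← sub_eq_add_neg, ← Finset.sum_sub_distrib, Real.exp_sum]
  refine Finset.prod_le_prod (fun i _ => (Real.exp_pos _).le) fun i _ => ?_
  have h1 := h (θ / H * √(n i)) (by positivity)
  have e1 : H * (θ / H * √(n i)) = θ * √(n i) := by field_simp
  have e2 : (θ / H * √(n i)) ^ 4 = (θ / H) ^ 4 * (n i : ℝ) ^ 2 := by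
    rw [mul_pow]; congr 1
    rw [show 4 = 2 * 2 from rfl, pow_mul, Real.sq_sqrt (by positivity)]
  rw [e1, e2] at h1
  rw [Real.exp_sub, div_le_div_iff₀ (Real.exp_pos _) (by positivity)]
  linarith

/-! ### Partial derivatives and multiplication by coordinates -/

section PartialDerivatives

variable {d : ℕ} {φ ψ : EuclideanSpace ℝ (Fin d) → ℂ}

theorem sub_single_add_single {α : Fin d → ℕ} {i : Fin d} (hi : α i ≠ 0) :
    α - Pi.single i 1 + Pi.single i 1 = α := by
  refine tsub_add_cancel_of_le fun j => ?_
  rcases eq_or_ne j i with rfl | hj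
  · simp; omega
  · simp [hj]

theorem pi_induction {P : (Fin d → ℕ) → Prop} (h0 : P 0)
    (h1 : ∀ α i, P α → P (α + Pi.single i 1)) (α : Fin d → ℕ) : P α := by
  induction hk : ∑ i, α i generalizing α with
  | zero =>
    have : α = 0 := funext fun i => by
      simpa using (Finset.sum_eq_zero_iff.1 hk) i (Finset.mem_univ i)
    exact this ▸ h0
  | succ k ih =>
    obtain ⟨i, hi⟩ : ∃ i, α i ≠ 0 := by
      by_contra! h
      simp [h] at hk
    have e := sub_single_add_single hi
    rw [← e]
    refine h1 _ _ (ih _ ?_)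
    rw [← e] at hk
    simpa [Finset.sum_add_distrib] using hk

theorem sum_add_single (α : Fin d → ℕ) (i : Fin d) :
    ∑ j, (α + Pi.single i 1 : Fin d → ℕ) j = (∑ j, α j) + 1 := by
  simp [Finset.sum_add_distrib]

theorem partialD_comm (i j : Fin d) (hφ : ContDiff ℝ ∞ φ) :
    partialD i (partialD j φ) = partialD j (partialD i φ) := by
  have hd : Differentiable ℝ (fderiv ℝ φ) :=
    (hφ.fderiv_right (m := ∞) (by simp)).differentiable (by simp)
  have key : ∀ (k l : Fin d) (x : EuclideanSpace ℝ (Fin d)), partialD k (partialD l φ) x =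
      fderiv ℝ (fderiv ℝ φ) x (EuclideanSpace.single k 1) (EuclideanSpace.single l 1) := by
    intro k l x
    have : partialD l φ = fun y => fderiv ℝ φ y (EuclideanSpace.single l 1) := rfl
    rw [this, partialD, fderiv_clm_apply (hd x) (by fun_prop)]
    simp
  funext x
  rw [key, key]
  have h2 : (2 : WithTop ℕ∞) ≤ ∞ := WithTop.coe_le_coe.2 le_top
  exact (hφ.contDiffAt.isSymmSndFDerivAt (by simpa using h2)) _ _

theorem partialD_iterate_comm (i j : Fin d) (k : ℕ) (hφ : ContDiff ℝ ∞ φ) :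
    (partialD j)^[k] (partialD i φ) = partialD i ((partialD j)^[k] φ) := by
  induction k with
  | zero => rfl
  | succ k ih =>
    rw [Function.iterate_succ_apply', Function.iterate_succ_apply', ih,
      partialD_comm _ _ (contDiff_iterate_partialD j k hφ)]

theorem foldr_partialD_comm (α : Fin d → ℕ) (i : Fin d) (hφ : ContDiff ℝ ∞ φ)
    (l : List (Fin d)) :
    l.foldr (fun j g => (partialD j)^[α j] g) (partialD i φ) =
      partialD i (l.foldr (fun j g => (partialD j)^[α j] g) φ) := by
  induction l with
  | nil => rfl
  | cons j l ih =>
    simp only [List.foldr_cons]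
    rw [ih, partialD_iterate_comm _ _ _ (foldr_partialD α 0 hφ hφ l).1]

theorem foldr_congr_of_forall {α β : Fin d → ℕ} (l : List (Fin d)) (h : ∀ j ∈ l, α j = β j) :
    l.foldr (fun j g => (partialD j)^[α j] g) φ =
      l.foldr (fun j g => (partialD j)^[β j] g) φ := by
  induction l with
  | nil => rfl
  | cons j l ih =>
    simp only [List.foldr_cons]
    rw [ih fun k hk => h k (List.mem_cons_of_mem _ hk), h j List.mem_cons_self]

theorem foldr_add_single (α : Fin d → ℕ) (i : Fin d) (hφ : ContDiff ℝ ∞ φ)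
    (l : List (Fin d)) (hl : l.Nodup) (hi : i ∈ l) :
    l.foldr (fun j g => (partialD j)^[(α + Pi.single i 1 : Fin d → ℕ) j] g) φ =
      partialD i (l.foldr (fun j g => (partialD j)^[α j] g) φ) := by
  induction l with
  | nil => simp at hi
  | cons j l ih =>
    rw [List.nodup_cons] at hl
    simp only [List.foldr_cons]
    rcases eq_or_ne j i with rfl | hj
    · rw [foldr_congr_of_forall (β := α) l, Pi.add_apply, Pi.single_eq_same,
        Function.iterate_succ_apply']
      intro k hk
      have : k ≠ j := fun h => hl.1 (h ▸ hk)
      simp [this]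
    · rw [ih hl.2 ((List.mem_cons.1 hi).resolve_left hj.symm),
        ← partialD_iterate_comm _ _ _ (foldr_partialD α 0 hφ hφ l).1]
      simp [hj]

theorem contDiff_mixedD (α : Fin d → ℕ) (hφ : ContDiff ℝ ∞ φ) : ContDiff ℝ ∞ (mixedD α φ) :=
  (foldr_partialD α 0 hφ hφ _).1

theorem mixedD_index_zero (φ : EuclideanSpace ℝ (Fin d) → ℂ) : mixedD 0 φ = φ := by
  simp only [mixedD, Pi.zero_apply, Function.iterate_zero, id]
  induction List.finRange d with
  | nil => rfl
  | cons i l ih => exact ih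

theorem mixedD_partialD (α : Fin d → ℕ) (i : Fin d) (hφ : ContDiff ℝ ∞ φ) :
    mixedD α (partialD i φ) = mixedD (α + Pi.single i 1) φ := by
  rw [mixedD, mixedD, foldr_partialD_comm α i hφ,
    foldr_add_single α i hφ _ (List.nodup_finRange d) (List.mem_finRange i)]

theorem partialD_mixedD (α : Fin d → ℕ) (i : Fin d) (hφ : ContDiff ℝ ∞ φ) :
    partialD i (mixedD α φ) = mixedD (α + Pi.single i 1) φ := by
  rw [mixedD, mixedD, foldr_add_single α i hφ _ (List.nodup_finRange d) (List.mem_finRange i)]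

/-- Multiplication by the `i`-th coordinate. -/
def coordMul (i : Fin d) (φ : EuclideanSpace ℝ (Fin d) → ℂ) : EuclideanSpace ℝ (Fin d) → ℂ :=
  fun x => (x i : ℂ) * φ x

theorem contDiff_coord (i : Fin d) :
    ContDiff ℝ ∞ fun x : EuclideanSpace ℝ (Fin d) => (x i : ℂ) :=
  Complex.ofRealCLM.contDiff.comp (EuclideanSpace.proj (𝕜 := ℝ) i).contDiff

theorem contDiff_coordMul (i : Fin d) (hφ : ContDiff ℝ ∞ φ) : ContDiff ℝ ∞ (coordMul i φ) :=
  (contDiff_coord i).mul hφ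

theorem partialD_coordMul (i j : Fin d) (hφ : ContDiff ℝ ∞ φ) :
    partialD j (coordMul i φ) = coordMul i (partialD j φ) + if i = j then φ else 0 := by
  funext x
  have h1 : HasFDerivAt (fun x : EuclideanSpace ℝ (Fin d) => (x i : ℂ))
      (Complex.ofRealCLM.comp (EuclideanSpace.proj (𝕜 := ℝ) i)) x :=
    (Complex.ofRealCLM.comp (EuclideanSpace.proj (𝕜 := ℝ) i)).hasFDerivAt
  have h2 : HasFDerivAt φ (fderiv ℝ φ x) x := (hφ.differentiable (by simp) x).hasFDerivAt
  have h3 := (h1.mul h2).fderiv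
  have h4 : coordMul i φ = (fun x : EuclideanSpace ℝ (Fin d) => (x i : ℂ)) * φ := rfl
  rw [partialD, h4, h3]
  simp only [Pi.add_apply, coordMul, partialD]
  split_ifs with h
  · subst h; simp
  · simp [h]

/-- The Leibniz rule for the product with a coordinate function. -/
theorem mixedD_coordMul (i : Fin d) (α : Fin d → ℕ) (hφ : ContDiff ℝ ∞ φ) :
    mixedD α (coordMul i φ) =
      coordMul i (mixedD α φ) + (α i : ℂ) • mixedD (α - Pi.single i 1) φ := by
  induction α using pi_induction generalizing φ with
  | h0 => simp [mixedD_index_zero]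
  | h1 α j ih =>
    have hj := contDiff_partialD j hφ
    rw [← mixedD_partialD _ _ (contDiff_coordMul i hφ), partialD_coordMul i j hφ]
    split_ifs with h
    · subst h
      rw [mixedD_add _ (contDiff_coordMul i hj) hφ, ih hj, mixedD_partialD _ _ hφ,
        mixedD_partialD _ _ hφ, add_tsub_cancel_right, add_assoc]
      congr 1
      rcases eq_or_ne (α i) 0 with h0 | h0
      · simp [h0]
      · rw [sub_single_add_single h0]
        simp [add_smul]
    · rw [add_zero, ih hj, mixedD_partialD _ _ hφ, mixedD_partialD _ _ hφ]
      have h5 : (α + Pi.single j 1 : Fin d → ℕ) i = α i := by simp [h]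
      have h6 : α + Pi.single j 1 - Pi.single i 1 = α - Pi.single i 1 + Pi.single j 1 := by
        funext k
        rcases eq_or_ne k i with rfl | hk
        · simp [h]
        · simp [hk]
      rw [h5, h6]

end PartialDerivatives

/-! ### Rapidly decreasing smooth functions -/

section RapidDecay

variable {d : ℕ} {φ ψ : EuclideanSpace ℝ (Fin d) → ℂ}

/-- The weight `(1+x²)^(β/2) = ∏ i, (1+x_i²)^(β_i/2)`. -/
def wt (β : Fin d → ℕ) (x : EuclideanSpace ℝ (Fin d)) : ℝ :=
  ∏ i, (1 + x i ^ 2) ^ ((β i : ℝ) / 2)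

theorem wt_pos (β : Fin d → ℕ) (x : EuclideanSpace ℝ (Fin d)) : 0 < wt β x :=
  Finset.prod_pos fun _ _ => Real.rpow_pos_of_pos (by positivity) _

theorem wt_zero (x : EuclideanSpace ℝ (Fin d)) : wt 0 x = 1 := by simp [wt]

theorem wt_add (β γ : Fin d → ℕ) (x : EuclideanSpace ℝ (Fin d)) :
    wt (β + γ) x = wt β x * wt γ x := by
  rw [wt, wt, wt, ← Finset.prod_mul_distrib]
  refine Finset.prod_congr rfl fun i _ => ?_
  rw [← Real.rpow_add (by positivity)]
  congr 1
  simp [add_div]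

theorem wt_single (i : Fin d) (x : EuclideanSpace ℝ (Fin d)) :
    wt (Pi.single i 1) x = √(1 + x i ^ 2) := by
  rw [wt, Finset.prod_eq_single i]
  · simp [Real.sqrt_eq_rpow]
  · intro j _ hj
    simp [hj]
  · simp

theorem abs_le_wt_single (i : Fin d) (x : EuclideanSpace ℝ (Fin d)) :
    |x i| ≤ wt (Pi.single i 1) x := by
  rw [wt_single]
  exact Real.abs_le_sqrt (by linarith)

theorem wt_single_le (i : Fin d) (x : EuclideanSpace ℝ (Fin d)) :
    wt (Pi.single i 1) x ≤ 1 + |x i| := by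
  rw [wt_single, Real.sqrt_le_left (by positivity)]
  nlinarith [sq_abs (x i), abs_nonneg (x i)]

theorem wt_two (x : EuclideanSpace ℝ (Fin d)) : wt (fun _ => 2) x = ∏ i, (1 + x i ^ 2) := by
  simp [wt]

theorem wt_one_sq (x : EuclideanSpace ℝ (Fin d)) : wt (fun _ => 1) x ^ 2 = wt (fun _ => 2) x := by
  rw [sq, ← wt_add]; rfl

theorem integrable_wt_two_inv :
    MeasureTheory.Integrable fun x : EuclideanSpace ℝ (Fin d) => (wt (fun _ => 2) x)⁻¹ := by
  have h1 : MeasureTheory.Integrable fun x : Fin d → ℝ => ∏ i, (1 + x i ^ 2)⁻¹ :=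
    MeasureTheory.Integrable.fintype_prod (f := fun (_ : Fin d) (t : ℝ) => (1 + t ^ 2)⁻¹)
      fun _ => integrable_inv_one_add_sq
  have h2 := (EuclideanSpace.volume_preserving_symm_measurableEquiv_toLp
    (Fin d)).integrable_comp_of_integrable h1
  refine h2.congr (Filter.Eventually.of_forall fun x => ?_)
  simp [wt_two]

/-- Smooth functions all of whose derivatives are bounded against every weight `wt β`. -/
def RapidDecay (φ : EuclideanSpace ℝ (Fin d) → ℂ) : Prop :=
  ContDiff ℝ ∞ φ ∧ ∀ α β : Fin d → ℕ, ∃ C : ℝ, ∀ x, wt β x * ‖mixedD α φ x‖ ≤ C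

namespace RapidDecay

theorem partialD (hφ : RapidDecay φ) (i : Fin d) : RapidDecay (partialD i φ) :=
  ⟨contDiff_partialD i hφ.1, fun α β => by
    rw [mixedD_partialD α i hφ.1]
    exact hφ.2 _ _⟩

theorem mixedD (hφ : RapidDecay φ) (α : Fin d → ℕ) : RapidDecay (mixedD α φ) := by
  induction α using pi_induction with
  | h0 => rwa [mixedD_index_zero]
  | h1 α i ih =>
    rw [← partialD_mixedD α i hφ.1]
    exact ih.partialD i

theorem add (hφ : RapidDecay φ) (hψ : RapidDecay ψ) : RapidDecay (φ + ψ) :=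
  ⟨hφ.1.add hψ.1, fun α β => by
    obtain ⟨A, hA⟩ := hφ.2 α β
    obtain ⟨B, hB⟩ := hψ.2 α β
    refine ⟨A + B, fun x => ?_⟩
    rw [mixedD_add α hφ.1 hψ.1]
    calc wt β x * ‖(GelfandShilov.mixedD α φ + GelfandShilov.mixedD α ψ) x‖
        ≤ wt β x * (‖GelfandShilov.mixedD α φ x‖ + ‖GelfandShilov.mixedD α ψ x‖) :=
          mul_le_mul_of_nonneg_left (norm_add_le _ _) (wt_pos β x).le
      _ ≤ A + B := by rw [mul_add]; exact add_le_add (hA x) (hB x)⟩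

theorem const_smul (hφ : RapidDecay φ) (c : ℂ) : RapidDecay (c • φ) :=
  ⟨hφ.1.const_smul c, fun α β => by
    obtain ⟨A, hA⟩ := hφ.2 α β
    refine ⟨‖c‖ * A, fun x => ?_⟩
    rw [mixedD_smul α c hφ.1, Pi.smul_apply, norm_smul, mul_left_comm]
    exact mul_le_mul_of_nonneg_left (hA x) (norm_nonneg c)⟩

theorem coordMul (hφ : RapidDecay φ) (i : Fin d) : RapidDecay (coordMul i φ) :=
  ⟨contDiff_coordMul i hφ.1, fun α β => by
    obtain ⟨A, hA⟩ := hφ.2 α (β + Pi.single i 1)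
    obtain ⟨B, hB⟩ := hφ.2 (α - Pi.single i 1) β
    refine ⟨A + α i * B, fun x => ?_⟩
    rw [mixedD_coordMul i α hφ.1]
    have h1 := hA x
    have h2 := hB x
    rw [wt_add] at h1
    have hw := wt_pos β x
    calc wt β x * ‖(GelfandShilov.coordMul i (GelfandShilov.mixedD α φ) +
          (α i : ℂ) • GelfandShilov.mixedD (α - Pi.single i 1) φ) x‖
        ≤ wt β x * (|x i| * ‖GelfandShilov.mixedD α φ x‖ +
            α i * ‖GelfandShilov.mixedD (α - Pi.single i 1) φ x‖) := by
          gcongr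
          refine (norm_add_le _ _).trans (le_of_eq ?_)
          simp [GelfandShilov.coordMul]
      _ ≤ wt β x * (wt (Pi.single i 1) x * ‖GelfandShilov.mixedD α φ x‖ +
            α i * ‖GelfandShilov.mixedD (α - Pi.single i 1) φ x‖) := by
          gcongr; exact abs_le_wt_single i x
      _ = wt β x * wt (Pi.single i 1) x * ‖GelfandShilov.mixedD α φ x‖ +
            α i * (wt β x * ‖GelfandShilov.mixedD (α - Pi.single i 1) φ x‖) := by ring
      _ ≤ A + α i * B := by gcongr⟩

theorem bounded (hφ : RapidDecay φ) : ∃ C, ∀ x, ‖φ x‖ ≤ C := by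
  obtain ⟨C, hC⟩ := hφ.2 0 0
  exact ⟨C, fun x => by simpa [wt_zero, mixedD_index_zero] using hC x⟩

theorem integrable (hφ : RapidDecay φ) : MeasureTheory.Integrable φ := by
  obtain ⟨C, hC⟩ := hφ.2 0 (fun _ => 2)
  refine (integrable_wt_two_inv.const_mul C).mono' hφ.1.continuous.aestronglyMeasurable
    (Filter.Eventually.of_forall fun x => ?_)
  have h1 := hC x
  rw [mixedD_index_zero] at h1
  rw [← div_eq_mul_inv, le_div_iff₀ (wt_pos _ x)]
  linarith

theorem integrable_mul (hφ : RapidDecay φ) (hψ : Continuous ψ) (hb : ∃ C, ∀ x, ‖ψ x‖ ≤ C) :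
    MeasureTheory.Integrable fun x => ψ x * φ x := by
  obtain ⟨C, hC⟩ := hb
  exact hφ.integrable.bdd_mul hψ.aestronglyMeasurable (Filter.Eventually.of_forall hC)

theorem integrable_mul' (hφ : RapidDecay φ) (hψ : RapidDecay ψ) :
    MeasureTheory.Integrable fun x => φ x * ψ x :=
  hψ.integrable_mul hφ.1.continuous hφ.bounded

theorem integral_mul_partialD (hφ : RapidDecay φ) (hψ : RapidDecay ψ) (i : Fin d) :
    ∫ x, φ x * GelfandShilov.partialD i ψ x = -∫ x, GelfandShilov.partialD i φ x * ψ x :=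
  integral_mul_fderiv_eq_neg_fderiv_mul_of_integrable
    ((hφ.partialD i).integrable_mul' hψ) (hφ.integrable_mul' (hψ.partialD i))
    (hφ.integrable_mul' hψ) (fun x _ => hφ.1.differentiable (by simp) x)
    (fun x _ => hψ.1.differentiable (by simp) x)

theorem integral_mul_mixedD (hφ : RapidDecay φ) (hψ : RapidDecay ψ) (α : Fin d → ℕ) :
    ∫ x, GelfandShilov.mixedD α φ x * ψ x =
      (-1) ^ (∑ i, α i) * ∫ x, φ x * GelfandShilov.mixedD α ψ x := by
  induction α using pi_induction generalizing ψ with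
  | h0 => simp [mixedD_index_zero]
  | h1 α i ih =>
    have h1 := (hφ.mixedD α).integral_mul_partialD hψ i
    rw [partialD_mixedD α i hφ.1, ih (hψ.partialD i), mixedD_partialD α i hψ.1] at h1
    rw [sum_add_single, pow_succ, mul_assoc, neg_one_mul, mul_neg, h1, neg_neg]

end RapidDecay

end RapidDecay

/-! ### Hermite functions on the line -/

section Line

open MeasureTheory

theorem contDiff_iteratedDeriv_gaussian (n : ℕ) :
    ContDiff ℝ ∞ (iteratedDeriv n fun t : ℝ => Real.exp (-t ^ 2)) := by
  rw [iteratedDeriv_eq_iterate]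
  exact ContDiff.iterate_deriv n (by fun_prop)

theorem hasDerivAt_iteratedDeriv_gaussian (n : ℕ) (x : ℝ) :
    HasDerivAt (iteratedDeriv n fun t : ℝ => Real.exp (-t ^ 2))
      (iteratedDeriv (n + 1) (fun t : ℝ => Real.exp (-t ^ 2)) x) x := by
  rw [iteratedDeriv_succ]
  exact ((contDiff_iteratedDeriv_gaussian n).differentiable (by simp) x).hasDerivAt

theorem iteratedDeriv_gaussian_rec (n : ℕ) (x : ℝ) :
    x * iteratedDeriv n (fun t : ℝ => Real.exp (-t ^ 2)) x =
      -(1 / 2) * iteratedDeriv (n + 1) (fun t : ℝ => Real.exp (-t ^ 2)) x -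
        n * iteratedDeriv (n - 1) (fun t : ℝ => Real.exp (-t ^ 2)) x := by
  induction n generalizing x with
  | zero =>
    have h : HasDerivAt (fun t : ℝ => Real.exp (-t ^ 2)) (Real.exp (-x ^ 2) * (-(2 * x))) x := by
      simpa using ((hasDerivAt_pow 2 x).neg).exp
    simp only [iteratedDeriv_zero, zero_add, iteratedDeriv_one, h.deriv]
    push_cast; ring
  | succ n ih =>
    have hl := (hasDerivAt_id x).mul (hasDerivAt_iteratedDeriv_gaussian n x)
    have hr := ((hasDerivAt_iteratedDeriv_gaussian (n + 1) x).const_mul (-(1 / 2) : ℝ)).sub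
      ((hasDerivAt_iteratedDeriv_gaussian (n - 1) x).const_mul (n : ℝ))
    have he : (id * iteratedDeriv n fun t : ℝ => Real.exp (-t ^ 2)) =
        (fun y => -(1 / 2) * iteratedDeriv (n + 1) (fun t : ℝ => Real.exp (-t ^ 2)) y) -
          fun y => (n : ℝ) * iteratedDeriv (n - 1) (fun t : ℝ => Real.exp (-t ^ 2)) y :=
      funext fun y => ih y
    rw [he] at hl
    have h := hl.unique hr
    simp only [id_eq, one_mul] at h
    rw [Nat.add_sub_cancel]
    rcases Nat.eq_zero_or_pos n with rfl | hn
    · simp only [Nat.cast_zero, zero_mul] at h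
      push_cast
      linarith
    · rw [Nat.sub_add_cancel hn] at h
      push_cast
      linarith

/-- The normalizing factor of `hermite1 n`, with its sign. -/
def hermiteFactor (n : ℕ) : ℝ :=
  (-1) ^ n * Real.pi ^ (-(1 / 4 : ℝ)) * 2 ^ (-(n : ℝ) / 2) * (n.factorial : ℝ) ^ (-(1 / 2 : ℝ))

theorem hermite1_eq (n : ℕ) (x : ℝ) : hermite1 n x = hermiteFactor n * Real.exp (x ^ 2 / 2) *
    iteratedDeriv n (fun t : ℝ => Real.exp (-t ^ 2)) x := rfl

theorem sqrt_mul_hermiteFactor_succ (n : ℕ) :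
    √(((n : ℝ) + 1) / 2) * hermiteFactor (n + 1) = -(1 / 2) * hermiteFactor n := by
  have h2 : (2 : ℝ) ^ (-((n : ℝ) + 1) / 2) = 2 ^ (-(n : ℝ) / 2) * 2 ^ (-(1 / 2 : ℝ)) := by
    rw [← Real.rpow_add two_pos]; congr 1; ring
  have h3 : (((n : ℝ) + 1) * (n.factorial : ℝ)) ^ (-(1 / 2 : ℝ)) =
      ((n : ℝ) + 1) ^ (-(1 / 2 : ℝ)) * (n.factorial : ℝ) ^ (-(1 / 2 : ℝ)) :=
    Real.mul_rpow (by positivity) (by positivity)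
  have h4 : √(((n : ℝ) + 1) / 2) = ((n : ℝ) + 1) ^ (1 / 2 : ℝ) * 2 ^ (-(1 / 2 : ℝ)) := by
    rw [Real.sqrt_eq_rpow, Real.div_rpow (by positivity) (by positivity),
      Real.rpow_neg two_pos.le]; rfl
  have h5 : ((n : ℝ) + 1) ^ (1 / 2 : ℝ) * ((n : ℝ) + 1) ^ (-(1 / 2 : ℝ)) = 1 := by
    rw [← Real.rpow_add (by positivity)]; simp
  have h6 : (2 : ℝ) ^ (-(1 / 2 : ℝ)) * 2 ^ (-(1 / 2 : ℝ)) = 1 / 2 := by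
    rw [← Real.rpow_add two_pos]; norm_num [Real.rpow_neg_one]
  simp only [hermiteFactor, Nat.factorial_succ]
  push_cast
  rw [h2, h3, h4, pow_succ]
  linear_combination (-(-1) ^ n * Real.pi ^ (-(1 / 4 : ℝ)) * 2 ^ (-(n : ℝ) / 2) *
    (n.factorial : ℝ) ^ (-(1 / 2 : ℝ))) * (2 ^ (-(1 / 2 : ℝ)) * 2 ^ (-(1 / 2 : ℝ)) * h5 + h6)

theorem sqrt_mul_hermite1_succ (n : ℕ) (x : ℝ) :
    √(((n : ℝ) + 1) / 2) * hermite1 (n + 1) x = -(1 / 2) * hermiteFactor n *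
      Real.exp (x ^ 2 / 2) * iteratedDeriv (n + 1) (fun t : ℝ => Real.exp (-t ^ 2)) x := by
  rw [hermite1_eq, ← mul_assoc, ← mul_assoc, sqrt_mul_hermiteFactor_succ]

theorem sqrt_mul_hermite1_pred (n : ℕ) (x : ℝ) :
    √((n : ℝ) / 2) * hermite1 (n - 1) x = -n * hermiteFactor n *
      Real.exp (x ^ 2 / 2) * iteratedDeriv (n - 1) (fun t : ℝ => Real.exp (-t ^ 2)) x := by
  cases n with
  | zero => simp
  | succ n =>
    have h1 := sqrt_mul_hermiteFactor_succ n
    have h2 : √(((n : ℝ) + 1) / 2) * √(((n : ℝ) + 1) / 2) = ((n : ℝ) + 1) / 2 :=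
      Real.mul_self_sqrt (by positivity)
    rw [Nat.add_sub_cancel, hermite1_eq]
    push_cast
    linear_combination (Real.exp (x ^ 2 / 2) *
      iteratedDeriv n (fun t : ℝ => Real.exp (-t ^ 2)) x) *
        (2 * √(((n : ℝ) + 1) / 2) * h1 - 2 * hermiteFactor (n + 1) * h2)

theorem mul_hermite1 (n : ℕ) (x : ℝ) : x * hermite1 n x =
    √((n : ℝ) / 2) * hermite1 (n - 1) x + √(((n : ℝ) + 1) / 2) * hermite1 (n + 1) x := by
  rw [sqrt_mul_hermite1_succ, sqrt_mul_hermite1_pred, hermite1_eq]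
  linear_combination hermiteFactor n * Real.exp (x ^ 2 / 2) * iteratedDeriv_gaussian_rec n x

theorem hasDerivAt_hermite1 (n : ℕ) (x : ℝ) : HasDerivAt (hermite1 n)
    (√((n : ℝ) / 2) * hermite1 (n - 1) x - √(((n : ℝ) + 1) / 2) * hermite1 (n + 1) x) x := by
  have h1 : HasDerivAt (fun y : ℝ => Real.exp (y ^ 2 / 2)) (Real.exp (x ^ 2 / 2) * x) x := by
    simpa using ((hasDerivAt_pow 2 x).div_const 2).exp
  have h2 := (h1.const_mul (hermiteFactor n)).mul (hasDerivAt_iteratedDeriv_gaussian n x)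
  refine h2.congr_deriv ?_
  rw [sqrt_mul_hermite1_succ, sqrt_mul_hermite1_pred]
  linear_combination hermiteFactor n * Real.exp (x ^ 2 / 2) * iteratedDeriv_gaussian_rec n x

theorem hermite1_zero (x : ℝ) :
    hermite1 0 x = Real.pi ^ (-(1 / 4 : ℝ)) * Real.exp (-(x ^ 2 / 2)) := by
  simp only [hermite1_eq, hermiteFactor, iteratedDeriv_zero]
  simp only [pow_zero, one_mul, Nat.cast_zero, neg_zero, zero_div, Real.rpow_zero, mul_one,
    Nat.factorial_zero, Nat.cast_one, Real.one_rpow, mul_assoc, ← Real.exp_add]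
  congr 2; ring

theorem contDiff_hermite1 (n : ℕ) : ContDiff ℝ ∞ (hermite1 n) := by
  have : hermite1 n = fun x => hermiteFactor n * Real.exp (x ^ 2 / 2) *
    iteratedDeriv n (fun t : ℝ => Real.exp (-t ^ 2)) x := rfl
  rw [this]
  exact ContDiff.mul (by fun_prop) (contDiff_iteratedDeriv_gaussian n)

theorem exists_abs_pow_mul_hermite1_le (n k : ℕ) : ∃ C : ℝ, ∀ x, |x| ^ k * |hermite1 n x| ≤ C := by
  induction n using Nat.strong_induction_on generalizing k with
  | _ n ih =>
    cases n with
    | zero =>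
      refine ⟨Real.pi ^ (-(1 / 4 : ℝ)) * (1 + 2 ^ k * k.factorial), fun x => ?_⟩
      have hpi : 0 < Real.pi ^ (-(1 / 4 : ℝ)) := Real.rpow_pos_of_pos Real.pi_pos _
      rw [hermite1_zero, abs_mul, abs_of_pos hpi, abs_of_pos (Real.exp_pos _), mul_left_comm]
      gcongr
      rw [Real.exp_neg, ← div_eq_mul_inv, div_le_iff₀ (Real.exp_pos _)]
      have h1 := Real.pow_div_factorial_le_exp (x ^ 2 / 2) (by positivity) k
      rw [div_pow, ← pow_mul, div_div, div_le_iff₀ (by positivity)] at h1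
      have h2 : (1 : ℝ) ≤ Real.exp (x ^ 2 / 2) := Real.one_le_exp (by positivity)
      have h3 : |x| ^ k ≤ 1 + x ^ (2 * k) := by
        rw [mul_comm, pow_mul, ← sq_abs, abs_pow]
        nlinarith [sq_nonneg (|x| ^ k - 1)]
      nlinarith
    | succ n =>
      obtain ⟨A, hA⟩ := ih n (Nat.lt_succ_self n) (k + 1)
      obtain ⟨B, hB⟩ := ih (n - 1) (by omega) k
      have hs : 0 < √(((n : ℝ) + 1) / 2) := Real.sqrt_pos.2 (by positivity)
      refine ⟨(A + √((n : ℝ) / 2) * B) / √(((n : ℝ) + 1) / 2), fun x => ?_⟩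
      rw [le_div_iff₀ hs]
      have h1 : √(((n : ℝ) + 1) / 2) * hermite1 (n + 1) x =
          x * hermite1 n x - √((n : ℝ) / 2) * hermite1 (n - 1) x := by
        rw [mul_hermite1 n x]; ring
      calc |x| ^ k * |hermite1 (n + 1) x| * √(((n : ℝ) + 1) / 2)
          = |x| ^ k * |√(((n : ℝ) + 1) / 2) * hermite1 (n + 1) x| := by
            rw [abs_mul, abs_of_pos hs]; ring
        _ ≤ |x| ^ k * (|x| * |hermite1 n x| + √((n : ℝ) / 2) * |hermite1 (n - 1) x|) := by
            rw [h1]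
            gcongr
            refine (abs_sub _ _).trans (le_of_eq ?_)
            rw [abs_mul, abs_mul, abs_of_nonneg (Real.sqrt_nonneg _)]
        _ = |x| ^ (k + 1) * |hermite1 n x| +
            √((n : ℝ) / 2) * (|x| ^ k * |hermite1 (n - 1) x|) := by ring
        _ ≤ A + √((n : ℝ) / 2) * B := by gcongr; exacts [hA x, hB x]

theorem integrable_hermite1 (n : ℕ) : Integrable (hermite1 n) := by
  obtain ⟨A, hA⟩ := exists_abs_pow_mul_hermite1_le n 0
  obtain ⟨B, hB⟩ := exists_abs_pow_mul_hermite1_le n 2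
  refine (integrable_inv_one_add_sq.const_mul (A + B)).mono'
    (contDiff_hermite1 n).continuous.aestronglyMeasurable (Filter.Eventually.of_forall fun x => ?_)
  have h1 := hA x
  have h2 := hB x
  rw [sq_abs] at h2
  rw [← div_eq_mul_inv, le_div_iff₀ (by positivity), Real.norm_eq_abs]
  linarith

theorem integrable_hermite1_mul (n m : ℕ) : Integrable fun x => hermite1 n x * hermite1 m x := by
  obtain ⟨A, hA⟩ := exists_abs_pow_mul_hermite1_le n 0
  exact (integrable_hermite1 m).bdd_mul (contDiff_hermite1 n).continuous.aestronglyMeasurable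
    (Filter.Eventually.of_forall fun x => by simpa using hA x)

/-- The creation operator is adjoint to the annihilation operator: the difference of the two
integrands is `-(1/2) (h_n h_m)'`, since the terms with a factor `x` cancel. -/
theorem sqrt_mul_integral_hermite1_succ (n m : ℕ) :
    √(((n : ℝ) + 1) / 2) * ∫ x, hermite1 (n + 1) x * hermite1 m x =
      √((m : ℝ) / 2) * ∫ x, hermite1 n x * hermite1 (m - 1) x := by
  have hi := integrable_hermite1_mul
  have hder : ∀ x, HasDerivAt (fun x => hermite1 n x * hermite1 m x)
      (-2 * (√(((n : ℝ) + 1) / 2) * (hermite1 (n + 1) x * hermite1 m x) -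
        √((m : ℝ) / 2) * (hermite1 n x * hermite1 (m - 1) x))) x := by
    intro x
    refine ((hasDerivAt_hermite1 n x).mul (hasDerivAt_hermite1 m x)).congr_deriv ?_
    linear_combination (-hermite1 m x) * mul_hermite1 n x + hermite1 n x * mul_hermite1 m x
  have h1 := (hi (n + 1) m).const_mul √(((n : ℝ) + 1) / 2)
  have h2 := (hi n (m - 1)).const_mul √((m : ℝ) / 2)
  have h := integral_eq_zero_of_hasDerivAt_of_integrable hder ((h1.sub h2).const_mul (-2)) (hi n m)
  rw [integral_const_mul, integral_sub h1 h2, integral_const_mul, integral_const_mul] at h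
  linarith

theorem integral_hermite1_mul (n m : ℕ) :
    ∫ x, hermite1 n x * hermite1 m x = if n = m then 1 else 0 := by
  have hz : ∀ k, ∫ x, hermite1 (k + 1) x * hermite1 0 x = 0 := by
    intro k
    have h := sqrt_mul_integral_hermite1_succ k 0
    have hs : √(((k : ℝ) + 1) / 2) ≠ 0 := (Real.sqrt_pos.2 (by positivity)).ne'
    rw [Nat.cast_zero, zero_div, Real.sqrt_zero, zero_mul] at h
    exact (mul_eq_zero.1 h).resolve_left hs
  induction n generalizing m with
  | zero =>
    cases m with
    | zero =>
      have h1 : ∀ x : ℝ, hermite1 0 x * hermite1 0 x =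
          Real.pi ^ (-(1 / 2 : ℝ)) * Real.exp (-1 * x ^ 2) := by
        intro x
        rw [hermite1_zero, mul_mul_mul_comm, ← Real.exp_add, ← Real.rpow_add Real.pi_pos]
        congr 2 <;> ring
      simp only [h1]
      rw [integral_const_mul, integral_gaussian, Real.sqrt_eq_rpow, div_one,
        ← Real.rpow_add Real.pi_pos]
      simp
    | succ k =>
      have := hz k
      simp only [mul_comm (hermite1 (k + 1) _)] at this
      simpa using this
  | succ n ih =>
    cases m with
    | zero => simpa using hz n
    | succ k =>
      have h := sqrt_mul_integral_hermite1_succ n (k + 1)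
      have hs : √(((n : ℝ) + 1) / 2) ≠ 0 := (Real.sqrt_pos.2 (by positivity)).ne'
      rw [Nat.add_sub_cancel, ih] at h
      push_cast at h
      split_ifs at h with hnk
      · subst hnk
        simpa using mul_left_cancel₀ hs (h.trans rfl)
      · have hnk' : n + 1 ≠ k + 1 := by omega
        rw [mul_zero] at h
        rw [if_neg hnk']
        exact (mul_eq_zero.1 h).resolve_left hs

/-- A crude uniform bound, from `h(x)² = ∫_{-∞}^x 2 h h' ≤ ∫ (h² + h'²)`. -/
theorem hermite1_sq_le (n : ℕ) (x : ℝ) : hermite1 n x ^ 2 ≤ 2 * ((n : ℝ) + 1) := by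
  have hi := integrable_hermite1_mul
  set D : ℝ → ℝ := fun y =>
    √((n : ℝ) / 2) * hermite1 (n - 1) y - √(((n : ℝ) + 1) / 2) * hermite1 (n + 1) y with hD
  have hD' : Integrable fun y => 2 * hermite1 n y * D y := by
    have := (((hi n (n - 1)).const_mul √((n : ℝ) / 2)).sub
      ((hi n (n + 1)).const_mul √(((n : ℝ) + 1) / 2))).const_mul 2
    refine this.congr (Filter.Eventually.of_forall fun x => ?_)
    simp only [Pi.sub_apply, hD]; ring
  have hsq : Integrable fun y => hermite1 n y ^ 2 := by simpa only [sq] using hi n n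
  have hder : ∀ y, HasDerivAt (fun y => hermite1 n y ^ 2) (2 * hermite1 n y * D y) y := by
    intro y
    refine ((hasDerivAt_hermite1 n y).fun_pow 2).congr_deriv ?_
    simp only [hD]; push_cast; ring
  have hlim := tendsto_zero_of_hasDerivAt_of_integrableOn_Iic (a := x) (fun y _ => hder y)
    hD'.integrableOn hsq.integrableOn
  have h1 := integral_Iic_of_hasDerivAt_of_tendsto' (a := x) (fun y _ => hder y)
    hD'.integrableOn hlim
  rw [sub_zero] at h1
  set B : ℝ → ℝ := fun y => hermite1 n y * hermite1 n y +
    (n * (hermite1 (n - 1) y * hermite1 (n - 1) y) +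
      (n + 1) * (hermite1 (n + 1) y * hermite1 (n + 1) y)) with hB
  have hi1 := (hi (n - 1) (n - 1)).const_mul (n : ℝ)
  have hi2 := (hi (n + 1) (n + 1)).const_mul ((n : ℝ) + 1)
  have hBi : Integrable B := (hi n n).add (hi1.add hi2)
  have hBle : ∀ y, 2 * hermite1 n y * D y ≤ B y := by
    intro y
    have s1 : √((n : ℝ) / 2) ^ 2 = n / 2 := Real.sq_sqrt (by positivity)
    have s2 : √(((n : ℝ) + 1) / 2) ^ 2 = (n + 1) / 2 := Real.sq_sqrt (by positivity)
    have h2 : D y ^ 2 ≤ n * (hermite1 (n - 1) y * hermite1 (n - 1) y) +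
        (n + 1) * (hermite1 (n + 1) y * hermite1 (n + 1) y) := by
      have e1 : n * (hermite1 (n - 1) y * hermite1 (n - 1) y) =
          2 * (√((n : ℝ) / 2) * hermite1 (n - 1) y) ^ 2 := by rw [mul_pow, s1]; ring
      have e2 : (n + 1) * (hermite1 (n + 1) y * hermite1 (n + 1) y) =
          2 * (√(((n : ℝ) + 1) / 2) * hermite1 (n + 1) y) ^ 2 := by rw [mul_pow, s2]; ring
      rw [e1, e2]
      simp only [hD]
      nlinarith [sq_nonneg (√((n : ℝ) / 2) * hermite1 (n - 1) y +
        √(((n : ℝ) + 1) / 2) * hermite1 (n + 1) y)]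
    have h3 := sq_nonneg (hermite1 n y - D y)
    simp only [hB]
    nlinarith
  have hB0 : ∀ y, 0 ≤ B y := fun y => by
    simp only [hB]
    have := mul_self_nonneg (hermite1 n y)
    have := mul_self_nonneg (hermite1 (n - 1) y)
    have := mul_self_nonneg (hermite1 (n + 1) y)
    positivity
  calc hermite1 n x ^ 2 = ∫ y in Set.Iic x, 2 * hermite1 n y * D y := h1.symm
    _ ≤ ∫ y in Set.Iic x, B y := integral_mono hD'.integrableOn hBi.integrableOn hBle
    _ ≤ ∫ y, B y := setIntegral_le_integral hBi (Filter.Eventually.of_forall hB0)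
    _ = 1 + (n * 1 + (n + 1) * 1) := by
      simp only [hB]
      refine (integral_add (hi n n) (hi1.add hi2)).trans ?_
      rw [integral_add' hi1 hi2, integral_const_mul, integral_const_mul]
      simp [integral_hermite1_mul]
    _ = 2 * ((n : ℝ) + 1) := by ring

end Line

/-! ### Hermite functions in several variables -/

section SeveralVariables

open MeasureTheory

variable {d : ℕ}

theorem contDiff_hermite (n : Fin d → ℕ) : ContDiff ℝ ∞ (hermite n) := by
  have h : ContDiff ℝ ∞ fun x : EuclideanSpace ℝ (Fin d) => ∏ k, hermite1 (n k) (x k) :=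
    contDiff_prod fun k _ => (contDiff_hermite1 (n k)).comp (EuclideanSpace.proj (𝕜 := ℝ) k).contDiff
  exact Complex.ofRealCLM.contDiff.comp h

theorem prod_hermite1_eq {n m : Fin d → ℕ} {x y : Fin d → ℝ} {i : Fin d}
    (h : ∀ j ≠ i, m j = n j ∧ y j = x j) :
    ∏ k, hermite1 (m k) (y k) =
      hermite1 (m i) (y i) * ∏ k ∈ Finset.univ.erase i, hermite1 (n k) (x k) := by
  rw [← Finset.mul_prod_erase _ _ (Finset.mem_univ i)]
  congr 1
  refine Finset.prod_congr rfl fun k hk => ?_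
  obtain ⟨h1, h2⟩ := h k (Finset.ne_of_mem_erase hk)
  rw [h1, h2]

theorem hermite_eq {n m : Fin d → ℕ} {x y : EuclideanSpace ℝ (Fin d)} {i : Fin d}
    (h : ∀ j ≠ i, m j = n j ∧ y j = x j) : hermite m y =
      ((hermite1 (m i) (y i) * ∏ k ∈ Finset.univ.erase i, hermite1 (n k) (x k) : ℝ) : ℂ) := by
  rw [hermite, prod_hermite1_eq h]

theorem coordMul_hermite (i : Fin d) (n : Fin d → ℕ) :
    coordMul i (hermite n) = ((√((n i : ℝ) / 2) : ℝ) : ℂ) • hermite (n - Pi.single i 1) +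
      ((√(((n i : ℝ) + 1) / 2) : ℝ) : ℂ) • hermite (n + Pi.single i 1) := by
  funext x
  rw [Pi.add_apply, Pi.smul_apply, Pi.smul_apply, coordMul,
    hermite_eq (n := n) (m := n) (x := x) (i := i) (by simp),
    hermite_eq (n := n) (m := n - Pi.single i 1) (x := x) (i := i) (fun j hj => by simp [hj]),
    hermite_eq (n := n) (m := n + Pi.single i 1) (x := x) (i := i) (fun j hj => by simp [hj])]
  simp only [Pi.sub_apply, Pi.add_apply, Pi.single_eq_same, smul_eq_mul]
  simp only [← Complex.ofReal_mul, ← Complex.ofReal_add]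
  rw [← mul_assoc, mul_hermite1]
  congr 1
  ring

theorem partialD_hermite (i : Fin d) (n : Fin d → ℕ) :
    partialD i (hermite n) = ((√((n i : ℝ) / 2) : ℝ) : ℂ) • hermite (n - Pi.single i 1) +
      (-(√(((n i : ℝ) + 1) / 2) : ℝ) : ℂ) • hermite (n + Pi.single i 1) := by
  funext x
  have hdiff : DifferentiableAt ℝ (hermite n) x :=
    (contDiff_hermite n).differentiable (by simp) x
  set R : ℝ := ∏ k ∈ Finset.univ.erase i, hermite1 (n k) (x k) with hR
  have hline : ∀ t : ℝ, hermite n (x + t • EuclideanSpace.single i 1) =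
      ((hermite1 (n i) (x i + t) * R : ℝ) : ℂ) := by
    intro t
    rw [hermite_eq (n := n) (x := x) (i := i) (fun j hj => by simp [hj])]
    congr 3
    simp
  have hd := (((hasDerivAt_hermite1 (n i) (x i + 0)).comp_const_add (x i) 0).mul_const R).ofReal_comp
  have hl := hdiff.hasFDerivAt.hasLineDerivAt (EuclideanSpace.single i 1)
  simp only [HasLineDerivAt, hline] at hl
  rw [Pi.add_apply, Pi.smul_apply, Pi.smul_apply, partialD, hl.unique hd,
    hermite_eq (n := n) (m := n - Pi.single i 1) (x := x) (i := i) (fun j hj => by simp [hj]),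
    hermite_eq (n := n) (m := n + Pi.single i 1) (x := x) (i := i) (fun j hj => by simp [hj])]
  simp only [Pi.sub_apply, Pi.add_apply, Pi.single_eq_same, add_zero, smul_eq_mul, ← hR]
  push_cast
  ring

/-- The bound `2 · 3^k · √((n+1)(n+2)⋯(n+k+1))` for the result of applying `k` operators, each of
them `d/dx` or multiplication by `√(1+x²)`, to the Hermite function of index `n`. -/
def hermiteBound (k n : ℕ) : ℝ := 2 * 3 ^ k * √((n + k + 1).factorial / n.factorial)

theorem hermiteBound_nonneg (k n : ℕ) : 0 ≤ hermiteBound k n := by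
  unfold hermiteBound; positivity

theorem hermiteBound_step (k n : ℕ) :
    hermiteBound k n + √((n : ℝ) / 2) * hermiteBound k (n - 1) +
      √(((n : ℝ) + 1) / 2) * hermiteBound k (n + 1) ≤ hermiteBound (k + 1) n := by
  set X : ℝ := √((n + (k + 1) + 1).factorial / n.factorial) with hX
  have h1 : √((n + k + 1).factorial / n.factorial) ≤ X := by
    refine Real.sqrt_le_sqrt ?_
    gcongr
    omega
  have h2 : √((n : ℝ) / 2) * √((n - 1 + k + 1).factorial / (n - 1).factorial) ≤ X := by
    cases n with
    | zero => simp [hX]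
    | succ m =>
      rw [← Real.sqrt_mul (by positivity)]
      refine Real.sqrt_le_sqrt ?_
      have e1 : m + 1 + (k + 1) + 1 = m + k + 1 + 1 + 1 := by ring
      have h0 : (0 : ℝ) < m.factorial := by positivity
      rw [Nat.add_sub_cancel, e1, Nat.factorial_succ (m + k + 1 + 1),
        Nat.factorial_succ (m + k + 1), Nat.factorial_succ m, div_mul_div_comm,
        div_le_div_iff₀ (by positivity) (by positivity)]
      push_cast
      have h3 : ((m : ℝ) + 1) * (m + 1) ≤ ((m : ℝ) + k + 1 + 1 + 1) * (m + k + 1 + 1) := by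
        gcongr <;> linarith [(Nat.cast_nonneg k : (0 : ℝ) ≤ k)]
      have h4 : (0 : ℝ) ≤ ((m + k + 1).factorial : ℝ) * m.factorial := by positivity
      nlinarith [mul_le_mul_of_nonneg_right h3 h4]
  have h3 : √(((n : ℝ) + 1) / 2) * √((n + 1 + k + 1).factorial / (n + 1).factorial) ≤ X := by
    rw [← Real.sqrt_mul (by positivity)]
    refine Real.sqrt_le_sqrt ?_
    have e1 : n + 1 + k + 1 = n + (k + 1) + 1 := by ring
    rw [e1, Nat.factorial_succ n, div_mul_div_comm, div_le_div_iff₀ (by positivity) (by positivity)]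
    push_cast
    have h4 : (0 : ℝ) ≤ ((n : ℝ) + 1) * (n + (k + 1) + 1).factorial * n.factorial := by positivity
    nlinarith
  unfold hermiteBound
  rw [← hX, pow_succ]
  have h4 : (0 : ℝ) ≤ 2 * 3 ^ k := by positivity
  nlinarith [mul_le_mul_of_nonneg_left h1 h4, mul_le_mul_of_nonneg_left h2 h4,
    mul_le_mul_of_nonneg_left h3 h4]

theorem abs_hermite1_le (n : ℕ) (x : ℝ) : |hermite1 n x| ≤ hermiteBound 0 n := by
  have h1 : ((n + 0 + 1).factorial : ℝ) / n.factorial = n + 1 := by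
    rw [add_zero, Nat.factorial_succ]; push_cast
    field_simp
  rw [hermiteBound, h1, pow_zero, mul_one]
  refine abs_le_of_sq_le_sq ?_ (by positivity)
  rw [mul_pow, Real.sq_sqrt (by positivity)]
  nlinarith [hermite1_sq_le n x]

theorem prod_hermiteBound_step (k n : Fin d → ℕ) (i : Fin d) :
    ∏ j, hermiteBound (k j) (n j) +
      √((n i : ℝ) / 2) * ∏ j, hermiteBound (k j) ((n - Pi.single i 1 : Fin d → ℕ) j) +
      √(((n i : ℝ) + 1) / 2) * ∏ j, hermiteBound (k j) ((n + Pi.single i 1 : Fin d → ℕ) j) ≤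
      ∏ j, hermiteBound ((k + Pi.single i 1 : Fin d → ℕ) j) (n j) := by
  have key : ∀ k' n' : Fin d → ℕ, (∀ j ≠ i, k' j = k j ∧ n' j = n j) →
      ∏ j, hermiteBound (k' j) (n' j) = hermiteBound (k' i) (n' i) *
        ∏ j ∈ Finset.univ.erase i, hermiteBound (k j) (n j) := by
    intro k' n' h
    rw [← Finset.mul_prod_erase _ _ (Finset.mem_univ i)]
    congr 1
    refine Finset.prod_congr rfl fun j hj => ?_
    obtain ⟨h1, h2⟩ := h j (Finset.ne_of_mem_erase hj)
    rw [h1, h2]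
  rw [key k n (by simp), key k (n - Pi.single i 1) (fun j hj => by simp [hj]),
    key k (n + Pi.single i 1) (fun j hj => by simp [hj]),
    key (k + Pi.single i 1) n (fun j hj => by simp [hj])]
  simp only [Pi.sub_apply, Pi.add_apply, Pi.single_eq_same]
  rw [← mul_assoc, ← mul_assoc, ← add_mul, ← add_mul]
  exact mul_le_mul_of_nonneg_right (hermiteBound_step _ _)
    (Finset.prod_nonneg fun _ _ => hermiteBound_nonneg _ _)

theorem wt_mul_norm_hermite_le (β n : Fin d → ℕ) (x : EuclideanSpace ℝ (Fin d)) :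
    wt β x * ‖hermite n x‖ ≤ ∏ j, hermiteBound (β j) (n j) := by
  induction β using pi_induction generalizing n with
  | h0 =>
    rw [wt_zero, one_mul, hermite, Complex.norm_real, Real.norm_eq_abs, Finset.abs_prod]
    exact Finset.prod_le_prod (fun _ _ => abs_nonneg _) fun j _ => abs_hermite1_le _ _
  | h1 β i ih =>
    refine le_trans ?_ (prod_hermiteBound_step β n i)
    have hw := (wt_pos β x).le
    have hs1 := Real.sqrt_nonneg ((n i : ℝ) / 2)
    have hs2 := Real.sqrt_nonneg (((n i : ℝ) + 1) / 2)
    calc wt (β + Pi.single i 1) x * ‖hermite n x‖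
        ≤ wt β x * (1 + |x i|) * ‖hermite n x‖ := by
          rw [wt_add]
          gcongr
          exact wt_single_le i x
      _ = wt β x * ‖hermite n x‖ + wt β x * ‖coordMul i (hermite n) x‖ := by
          rw [coordMul, norm_mul, Complex.norm_real, Real.norm_eq_abs]; ring
      _ ≤ wt β x * ‖hermite n x‖ + wt β x * (√((n i : ℝ) / 2) *
            ‖hermite (n - Pi.single i 1) x‖ +
            √(((n i : ℝ) + 1) / 2) * ‖hermite (n + Pi.single i 1) x‖) := by
          gcongr
          rw [coordMul_hermite]
          refine (norm_add_le _ _).trans (le_of_eq ?_)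
          rw [Pi.smul_apply, Pi.smul_apply, norm_smul, norm_smul, Complex.norm_of_nonneg hs1,
            Complex.norm_of_nonneg hs2]
      _ = wt β x * ‖hermite n x‖ + √((n i : ℝ) / 2) *
            (wt β x * ‖hermite (n - Pi.single i 1) x‖) +
            √(((n i : ℝ) + 1) / 2) * (wt β x * ‖hermite (n + Pi.single i 1) x‖) := by ring
      _ ≤ _ := by gcongr <;> exact ih _

theorem wt_mul_norm_mixedD_hermite_le (α β n : Fin d → ℕ) (x : EuclideanSpace ℝ (Fin d)) :
    wt β x * ‖mixedD α (hermite n) x‖ ≤ ∏ j, hermiteBound (α j + β j) (n j) := by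
  induction α using pi_induction generalizing n with
  | h0 => simpa [mixedD_index_zero] using wt_mul_norm_hermite_le β n x
  | h1 α i ih =>
    have e : ∀ j, (α + Pi.single i 1 : Fin d → ℕ) j + β j =
        ((α + β) + Pi.single i 1 : Fin d → ℕ) j := fun j => by
      simp only [Pi.add_apply]; ring
    simp only [e]
    refine le_trans ?_ (prod_hermiteBound_step (α + β) n i)
    have hw := (wt_pos β x).le
    have hs1 := Real.sqrt_nonneg ((n i : ℝ) / 2)
    have hs2 := Real.sqrt_nonneg (((n i : ℝ) + 1) / 2)
    have hc : ∀ (c : ℂ) (m : Fin d → ℕ), ContDiff ℝ ∞ (c • hermite m) :=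
      fun c m => (contDiff_hermite m).const_smul c
    rw [← mixedD_partialD α i (contDiff_hermite n), partialD_hermite,
      mixedD_add _ (hc _ _) (hc _ _),
      mixedD_smul _ _ (contDiff_hermite _), mixedD_smul _ _ (contDiff_hermite _)]
    calc wt β x * ‖(((√((n i : ℝ) / 2) : ℝ) : ℂ) • mixedD α (hermite (n - Pi.single i 1)) +
          (-(√(((n i : ℝ) + 1) / 2) : ℝ) : ℂ) • mixedD α (hermite (n + Pi.single i 1))) x‖
        ≤ wt β x * (√((n i : ℝ) / 2) * ‖mixedD α (hermite (n - Pi.single i 1)) x‖ +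
            √(((n i : ℝ) + 1) / 2) * ‖mixedD α (hermite (n + Pi.single i 1)) x‖) := by
          gcongr
          refine (norm_add_le _ _).trans (le_of_eq ?_)
          rw [Pi.smul_apply, Pi.smul_apply, norm_smul, norm_smul, norm_neg,
            Complex.norm_of_nonneg hs1, Complex.norm_of_nonneg hs2]
      _ = 0 + √((n i : ℝ) / 2) * (wt β x * ‖mixedD α (hermite (n - Pi.single i 1)) x‖) +
            √(((n i : ℝ) + 1) / 2) * (wt β x * ‖mixedD α (hermite (n + Pi.single i 1)) x‖) := by
          ring
      _ ≤ _ := by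
          gcongr
          · exact Finset.prod_nonneg fun _ _ => hermiteBound_nonneg _ _
          · exact ih _
          · exact ih _

theorem rapidDecay_hermite (n : Fin d → ℕ) : RapidDecay (hermite n) :=
  ⟨contDiff_hermite n, fun α β => ⟨_, fun x => wt_mul_norm_mixedD_hermite_le α β n x⟩⟩

theorem integral_prod_hermite1_mul (n m : Fin d → ℕ) :
    ∫ x : EuclideanSpace ℝ (Fin d),
      (∏ k, hermite1 (n k) (x k)) * ∏ k, hermite1 (m k) (x k) = if n = m then 1 else 0 := by
  have h1 := (EuclideanSpace.volume_preserving_symm_measurableEquiv_toLp (Fin d)).integral_comp'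
    (fun x : Fin d → ℝ => ∏ k, hermite1 (n k) (x k) * hermite1 (m k) (x k))
  rw [integral_fintype_prod_volume_eq_prod (fun (k : Fin d) (t : ℝ) =>
    hermite1 (n k) t * hermite1 (m k) t)] at h1
  simp only [integral_hermite1_mul, ← Finset.prod_mul_distrib] at h1 ⊢
  refine h1.trans ?_
  split_ifs with h
  · simp [h]
  · obtain ⟨k, hk⟩ := Function.ne_iff.1 h
    exact Finset.prod_eq_zero (Finset.mem_univ k) (if_neg hk)

theorem integral_hermite_mul (n m : Fin d → ℕ) :
    ∫ x : EuclideanSpace ℝ (Fin d), hermite n x * hermite m x = if n = m then 1 else 0 := by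
  have h := congrArg (fun r : ℝ => (r : ℂ)) (integral_prod_hermite1_mul n m)
  simp only [← integral_complex_ofReal] at h
  simp only [hermite, ← Complex.ofReal_mul, h]
  split_ifs <;> simp

theorem integral_norm_hermite_sq (n : Fin d → ℕ) :
    ∫ x : EuclideanSpace ℝ (Fin d), ‖hermite n x‖ ^ 2 = 1 := by
  have h := integral_prod_hermite1_mul n n
  rw [if_pos rfl] at h
  rw [← h]
  congr 1; funext x
  rw [hermite, Complex.norm_real, Real.norm_eq_abs, sq_abs, sq]

theorem integrable_norm_hermite_sq (n : Fin d → ℕ) :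
    Integrable fun x : EuclideanSpace ℝ (Fin d) => ‖hermite n x‖ ^ 2 :=
  Integrable.of_integral_ne_zero (by rw [integral_norm_hermite_sq]; exact one_ne_zero)

end SeveralVariables

/-! ### Hermite functions as elements of the Gelfand-Shilov space -/

section HermiteNorm

variable {M : WeightSequence} {d : ℕ}

theorem sqrt_factorial_div_le (n j : ℕ) :
    √((n + j).factorial / n.factorial) ≤ 2 ^ j * (√(n : ℝ) ^ j + √(j : ℝ) ^ j) := by
  have h1 : ((n + j).factorial : ℝ) / n.factorial ≤ ((n : ℝ) + j) ^ j := by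
    rw [div_le_iff₀ (by positivity), ← Nat.factorial_mul_ascFactorial, mul_comm]
    push_cast
    gcongr
    exact_mod_cast Nat.ascFactorial_le_pow_add n j
  have h2 : √((n : ℝ) + j) ≤ 2 * max √(n : ℝ) √(j : ℝ) := by
    have hn := Nat.cast_nonneg (α := ℝ) n
    have hj := Nat.cast_nonneg (α := ℝ) j
    rw [Real.sqrt_le_left (by positivity), mul_pow]
    rcases le_total (n : ℝ) j with h | h
    · rw [max_eq_right (Real.sqrt_le_sqrt h), Real.sq_sqrt hj]; linarith
    · rw [max_eq_left (Real.sqrt_le_sqrt h), Real.sq_sqrt hn]; linarith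
  have h3 : max √(n : ℝ) √(j : ℝ) ^ j ≤ √(n : ℝ) ^ j + √(j : ℝ) ^ j := by
    rcases le_total √(n : ℝ) √(j : ℝ) with h | h
    · rw [max_eq_right h]; exact le_add_of_nonneg_left (by positivity)
    · rw [max_eq_left h]; exact le_add_of_nonneg_right (by positivity)
  calc √((n + j).factorial / n.factorial) ≤ √(((n : ℝ) + j) ^ j) := Real.sqrt_le_sqrt h1
    _ = √((n : ℝ) + j) ^ j := by
      rw [Real.sqrt_eq_iff_mul_self_eq (by positivity) (by positivity), ← mul_pow,
        Real.mul_self_sqrt (by positivity)]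
    _ ≤ (2 * max √(n : ℝ) √(j : ℝ)) ^ j := by gcongr
    _ = 2 ^ j * max √(n : ℝ) √(j : ℝ) ^ j := mul_pow _ _ _
    _ ≤ _ := by gcongr

theorem exists_hermiteBound_le (hM2 : M.Separative) (hM3 : M.NonTrivial) {θ : ℝ} (hθ : 0 < θ) :
    ∃ C K : ℝ, 0 < C ∧ 0 < K ∧ ∀ k n : ℕ,
      hermiteBound k n ≤ C * K ^ k * M k * Real.exp (M.assoc (θ * √n)) := by
  obtain ⟨C, L, hC, hL, h⟩ := M.exists_sqrt_pow_le hM3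
  obtain ⟨A, H, hA, hH, hAH⟩ := M.exists_add_le hM2
  set T : ℝ := 2 * (θ⁻¹ + L) * H with hT
  have hT0 : 0 < T := by positivity
  have h1 := M.pos' 1
  refine ⟨2 * (1 + C) * A * T * M 1, 3 * T, by positivity, by positivity, fun k n => ?_⟩
  set e := Real.exp (M.assoc (θ * √n)) with he
  have he0 : 0 < e := Real.exp_pos _
  have he1 : 1 ≤ e := by
    have := M.pow_le_mul_exp_assoc hM3 (ρ := θ * √n) (by positivity) 0
    rwa [pow_zero, M.zero', one_mul] at this
  have hk := M.pos' k
  have hk1 := M.pos' (k + 1)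
  have a1 : √(n : ℝ) ^ (k + 1) ≤ (θ⁻¹ + L) ^ (k + 1) * (M (k + 1) * e) := by
    have := M.pow_le_mul_exp_assoc hM3 (ρ := θ * √n) (by positivity) (k + 1)
    calc √(n : ℝ) ^ (k + 1) = θ⁻¹ ^ (k + 1) * (θ * √n) ^ (k + 1) := by
          rw [← mul_pow]; congr 1; field_simp
      _ ≤ θ⁻¹ ^ (k + 1) * (M (k + 1) * e) := by gcongr
      _ ≤ _ := by gcongr; linarith
  have a2 : √((k + 1 : ℕ) : ℝ) ^ (k + 1) ≤ C * (θ⁻¹ + L) ^ (k + 1) * (M (k + 1) * e) := by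
    calc √((k + 1 : ℕ) : ℝ) ^ (k + 1) ≤ C * L ^ (k + 1) * M (k + 1) := h (k + 1)
      _ ≤ C * (θ⁻¹ + L) ^ (k + 1) * (M (k + 1) * e) := by
        have : 0 < θ⁻¹ := by positivity
        gcongr
        · linarith
        · exact le_mul_of_one_le_right hk1.le he1
  calc hermiteBound k n = 2 * 3 ^ k * √((n + (k + 1)).factorial / n.factorial) := rfl
    _ ≤ 2 * 3 ^ k * (2 ^ (k + 1) * (√(n : ℝ) ^ (k + 1) + √((k + 1 : ℕ) : ℝ) ^ (k + 1))) := by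
      gcongr; exact sqrt_factorial_div_le n (k + 1)
    _ ≤ 2 * 3 ^ k * (2 ^ (k + 1) * ((θ⁻¹ + L) ^ (k + 1) * (M (k + 1) * e) +
        C * (θ⁻¹ + L) ^ (k + 1) * (M (k + 1) * e))) := by gcongr
    _ = 2 * (1 + C) * 3 ^ k * (2 * (θ⁻¹ + L)) ^ (k + 1) * e * M (k + 1) := by
      rw [mul_pow 2 (θ⁻¹ + L)]; ring
    _ ≤ 2 * (1 + C) * 3 ^ k * (2 * (θ⁻¹ + L)) ^ (k + 1) * e *
        (A * H ^ (k + 1) * (M k * M 1)) := by gcongr; exact hAH k 1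
    _ = 2 * (1 + C) * A * T * M 1 * (3 * T) ^ k * M k * e := by
      rw [hT]
      generalize 2 * (θ⁻¹ + L) = Y
      ring

theorem weightedTerm_eq (m : ℝ) (φ : EuclideanSpace ℝ (Fin d) → ℂ)
    (q : (Fin d → ℕ) × (Fin d → ℕ) × EuclideanSpace ℝ (Fin d)) :
    weightedTerm M m φ q = m ^ ((∑ i, q.1 i) + ∑ i, q.2.1 i) /
      (M (∑ i, q.1 i) * M (∑ i, q.2.1 i)) * (wt q.2.1 q.2.2 * ‖mixedD q.1 φ q.2.2‖) := rfl

/-- The Hermite functions grow in the norms of the steps at most like the associated function, for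
every `θ`: the smaller `θ` is, the larger the step has to be chosen. -/
theorem exists_weightedTerm_hermite_le (hM1 : M.LogConvex) (hM2 : M.Separative)
    (hM3 : M.NonTrivial) (d : ℕ) {θ : ℝ} (hθ : 0 < θ) :
    ∃ m : {r : ℝ // 0 < r}, ∃ C : ℝ, 0 < C ∧ ∀ (n : Fin d → ℕ) q,
      weightedTerm M m.1 (hermite n) q ≤ C * Real.exp (∑ i, M.assoc (θ * √(n i))) := by
  obtain ⟨C, K, hC, hK, h⟩ := exists_hermiteBound_le hM2 hM3 hθ
  obtain ⟨A, H, hA, hH, hAH⟩ := M.exists_add_le hM2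
  refine ⟨⟨(K * H)⁻¹, by positivity⟩, C ^ d * A, by positivity, ?_⟩
  rintro n ⟨α, β, x⟩
  rw [weightedTerm_eq]
  dsimp only
  set a := ∑ i, α i
  set b := ∑ i, β i
  have ha := M.pos' a
  have hb := M.pos' b
  have hab : ∑ i, (α i + β i) = a + b := Finset.sum_add_distrib
  set E := Real.exp (∑ i, M.assoc (θ * √(n i))) with hE
  have hE0 : 0 < E := Real.exp_pos _
  have key : wt β x * ‖mixedD α (hermite n) x‖ ≤
      C ^ d * K ^ (a + b) * (A * H ^ (a + b) * (M a * M b)) * E := by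
    calc wt β x * ‖mixedD α (hermite n) x‖ ≤ ∏ j, hermiteBound (α j + β j) (n j) :=
          wt_mul_norm_mixedD_hermite_le α β n x
      _ ≤ ∏ j, (C * K ^ (α j + β j) * M (α j + β j) * Real.exp (M.assoc (θ * √(n j)))) :=
          Finset.prod_le_prod (fun _ _ => hermiteBound_nonneg _ _) fun j _ => h _ _
      _ = C ^ d * K ^ (a + b) * (∏ j, M (α j + β j)) * E := by
          rw [Finset.prod_mul_distrib, Finset.prod_mul_distrib, Finset.prod_mul_distrib,
            Finset.prod_pow_eq_pow_sum, hab, hE, Real.exp_sum]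
          simp
      _ ≤ C ^ d * K ^ (a + b) * M (a + b) * E := by
          gcongr
          rw [← hab]
          exact hM1.prod_le _ _
      _ ≤ _ := by gcongr; exact hAH a b
  calc (K * H)⁻¹ ^ (a + b) / (M a * M b) * (wt β x * ‖mixedD α (hermite n) x‖)
      ≤ (K * H)⁻¹ ^ (a + b) / (M a * M b) *
        (C ^ d * K ^ (a + b) * (A * H ^ (a + b) * (M a * M b)) * E) := by gcongr
    _ = C ^ d * A * E := by
      rw [inv_pow, mul_pow]
      field_simp

end HermiteNorm

/-! ### Decay of the Hermite coefficients of test functions -/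

section Decay

open MeasureTheory

variable {M : WeightSequence} {d : ℕ} {ψ : EuclideanSpace ℝ (Fin d) → ℂ}

/-- The operator `x_i + ∂/∂x_i`, a multiple of the annihilation operator. -/
def annihilation (i : Fin d) (ψ : EuclideanSpace ℝ (Fin d) → ℂ) : EuclideanSpace ℝ (Fin d) → ℂ :=
  coordMul i ψ + partialD i ψ

theorem RapidDecay.annihilation (hψ : RapidDecay ψ) (i : Fin d) :
    RapidDecay (annihilation i ψ) :=
  (hψ.coordMul i).add (hψ.partialD i)

theorem two_mul_sqrt_mul_integral (hψ : RapidDecay ψ) (i : Fin d) (n : Fin d → ℕ) :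
    ((2 * √(((n i : ℝ) + 1) / 2) : ℝ) : ℂ) * ∫ x, ψ x * hermite (n + Pi.single i 1) x =
      ∫ x, annihilation i ψ x * hermite n x := by
  have hH := rapidDecay_hermite n
  have h1 : ∫ x, annihilation i ψ x * hermite n x =
      ∫ x, (ψ x * coordMul i (hermite n) x - ψ x * partialD i (hermite n) x) := by
    rw [integral_sub (hψ.integrable_mul' (hH.coordMul i)) (hψ.integrable_mul' (hH.partialD i)),
      hψ.integral_mul_partialD hH, sub_neg_eq_add,
      ← integral_add (hψ.integrable_mul' (hH.coordMul i)) ((hψ.partialD i).integrable_mul' hH)]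
    congr 1; funext x
    simp only [GelfandShilov.annihilation, Pi.add_apply, coordMul]
    ring
  rw [h1, ← integral_const_mul]
  congr 1; funext x
  rw [coordMul_hermite, partialD_hermite]
  simp only [Pi.add_apply, Pi.smul_apply, smul_eq_mul]
  push_cast
  ring

/-- All derivatives of `ψ` are bounded, against all weights, by `K s^(|α|+|β|) M_{Q+|α|+|β|}`. The
offset `Q` counts the annihilation operators that have been applied to a test function. -/
def GrowthBound (M : WeightSequence) (K s : ℝ) (Q : ℕ) (ψ : EuclideanSpace ℝ (Fin d) → ℂ) : Prop :=
  ∀ (α β : Fin d → ℕ) (x : EuclideanSpace ℝ (Fin d)),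
    wt β x * ‖mixedD α ψ x‖ ≤ K * s ^ ((∑ i, α i) + ∑ i, β i) * M (Q + ((∑ i, α i) + ∑ i, β i))

/-- The commutator of `∂^α` with `x_i` costs a factor `α_i` and two orders; this is paid for by
`q M_{q-1} ≤ c M_{q+1}`. -/
theorem GrowthBound.annihilation {K s c : ℝ} {Q : ℕ} (hK : 0 ≤ K) (hs : 0 < s) (hc0 : 0 < c)
    (hc : ∀ q : ℕ, ((q : ℝ) + 1) * M q ≤ c * M (q + 2)) (hψ : ContDiff ℝ ∞ ψ)
    (h : GrowthBound M K s Q ψ) (i : Fin d) :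
    GrowthBound M (K * (2 * s + c / s)) s (Q + 1) (annihilation i ψ) := by
  intro α β x
  have hw := wt_pos β x
  rw [GelfandShilov.annihilation, mixedD_add _ (contDiff_coordMul i hψ) (contDiff_partialD i hψ),
    mixedD_coordMul i α hψ, mixedD_partialD α i hψ]
  set t := (∑ i, α i) + ∑ i, β i with ht
  have h1 := h α (β + Pi.single i 1) x
  have h2 := h (α + Pi.single i 1) β x
  rw [sum_add_single, wt_add] at h1
  rw [sum_add_single] at h2
  rw [← add_assoc, ← ht] at h1
  rw [add_right_comm, ← ht] at h2
  have e1 : Q + (t + 1) = Q + 1 + t := by ring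
  rw [e1] at h1 h2
  have hMt := M.pos' (Q + 1 + t)
  have h3 : (α i : ℝ) * (wt β x * ‖mixedD (α - Pi.single i 1) ψ x‖) ≤
      K * (c / s) * s ^ t * M (Q + 1 + t) := by
    rcases eq_or_ne (α i) 0 with h0 | h0
    · rw [h0, Nat.cast_zero, zero_mul]
      positivity
    · have h4 := h (α - Pi.single i 1) β x
      have e2 : ∑ j, α j = (∑ j, (α - Pi.single i 1 : Fin d → ℕ) j) + 1 := by
        rw [← sum_add_single _ i, sub_single_add_single h0]
      set u := (∑ j, (α - Pi.single i 1 : Fin d → ℕ) j) + ∑ j, β j with hu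
      have e3 : t = u + 1 := by rw [ht, hu, e2]; ring
      have h5 : (α i : ℝ) ≤ ((Q + u : ℕ) : ℝ) + 1 := by
        have : α i ≤ ∑ j, α j := Finset.single_le_sum (fun _ _ => Nat.zero_le _) (Finset.mem_univ i)
        have : α i ≤ Q + u + 1 := by omega
        exact_mod_cast this
      have hMu := M.pos' (Q + u)
      have e4 : Q + 1 + (u + 1) = Q + u + 2 := by ring
      rw [e3, e4]
      calc (α i : ℝ) * (wt β x * ‖mixedD (α - Pi.single i 1) ψ x‖)
          ≤ (((Q + u : ℕ) : ℝ) + 1) * (K * s ^ u * M (Q + u)) := by gcongr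
        _ = K * s ^ u * ((((Q + u : ℕ) : ℝ) + 1) * M (Q + u)) := by ring
        _ ≤ K * s ^ u * (c * M (Q + u + 2)) :=
            mul_le_mul_of_nonneg_left (hc _) (by positivity)
        _ = K * (c / s) * s ^ (u + 1) * M (Q + u + 2) := by rw [pow_succ]; field_simp
  calc wt β x * ‖(coordMul i (mixedD α ψ) + (α i : ℂ) • mixedD (α - Pi.single i 1) ψ +
        mixedD (α + Pi.single i 1) ψ) x‖
      ≤ wt β x * (wt (Pi.single i 1) x * ‖mixedD α ψ x‖ +
        α i * ‖mixedD (α - Pi.single i 1) ψ x‖ + ‖mixedD (α + Pi.single i 1) ψ x‖) := by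
        gcongr
        refine (norm_add_le _ _).trans (add_le_add_left ((norm_add_le _ _).trans ?_) _)
        rw [coordMul, norm_mul, Complex.norm_real, Real.norm_eq_abs, Pi.smul_apply, norm_smul,
          Complex.norm_natCast]
        gcongr
        exact abs_le_wt_single i x
    _ = wt β x * wt (Pi.single i 1) x * ‖mixedD α ψ x‖ +
        α i * (wt β x * ‖mixedD (α - Pi.single i 1) ψ x‖) +
        wt β x * ‖mixedD (α + Pi.single i 1) ψ x‖ := by ring
    _ ≤ K * s ^ (t + 1) * M (Q + 1 + t) + K * (c / s) * s ^ t * M (Q + 1 + t) +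
        K * s ^ (t + 1) * M (Q + 1 + t) := by gcongr
    _ = _ := by ring

/-- The constant in the Cauchy-Schwarz estimate `norm_integral_mul_hermite_le`. -/
def integralConst (d : ℕ) : ℝ :=
  ((∫ x : EuclideanSpace ℝ (Fin d), (wt (fun _ => 2) x)⁻¹) + 1) / 2

theorem integralConst_pos (d : ℕ) : 0 < integralConst d := by
  have : 0 ≤ ∫ x : EuclideanSpace ℝ (Fin d), (wt (fun _ => 2) x)⁻¹ :=
    integral_nonneg fun x => (inv_pos.2 (wt_pos _ x)).le
  unfold integralConst
  linarith

theorem norm_integral_mul_hermite_le {S : ℝ} (hS : ∀ x, wt (fun _ => 1) x * ‖ψ x‖ ≤ S)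
    (n : Fin d → ℕ) : ‖∫ x, ψ x * hermite n x‖ ≤ S * integralConst d := by
  have hS0 : 0 ≤ S := (mul_nonneg (wt_pos _ 0).le (norm_nonneg _)).trans (hS 0)
  have hi := ((integrable_wt_two_inv (d := d)).add (integrable_norm_hermite_sq n)).const_mul (S / 2)
  refine (norm_integral_le_of_norm_le hi (Filter.Eventually.of_forall fun x => ?_)).trans
    (le_of_eq ?_)
  · have hw := wt_pos (fun _ => 1) x
    have h1 : ‖ψ x‖ ≤ S * (wt (fun _ => 1) x)⁻¹ := by
      rw [← div_eq_mul_inv, le_div_iff₀ hw, mul_comm]; exact hS x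
    rw [norm_mul, Pi.add_apply, ← wt_one_sq, ← inv_pow]
    calc ‖ψ x‖ * ‖hermite n x‖ ≤ S * (wt (fun _ => 1) x)⁻¹ * ‖hermite n x‖ := by gcongr
      _ ≤ _ := by nlinarith [sq_nonneg ((wt (fun _ => 1) x)⁻¹ - ‖hermite n x‖)]
  · rw [integral_const_mul, integral_add' integrable_wt_two_inv (integrable_norm_hermite_sq n),
      integral_norm_hermite_sq, integralConst]
    ring

theorem GrowthBound.prod_pow_mul_norm_integral_le {K s c : ℝ} {Q : ℕ} (hK : 0 ≤ K) (hs : 0 < s)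
    (hc0 : 0 < c) (hc : ∀ q : ℕ, ((q : ℝ) + 1) * M q ≤ c * M (q + 2)) (hψ : RapidDecay ψ)
    (h : GrowthBound M K s Q ψ) (n p : Fin d → ℕ) (ρ : Fin d → ℝ) (hρ0 : ∀ i, 0 ≤ ρ i)
    (hρ : ∀ i, ρ i ^ 2 ≤ 2 * ((n i : ℝ) + 1)) :
    (∏ i, ρ i ^ p i) * ‖∫ x, ψ x * hermite (n + p) x‖ ≤
      K * (2 * s + c / s) ^ (∑ i, p i) * s ^ d * M (Q + (∑ i, p i) + d) * integralConst d := by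
  induction p using pi_induction generalizing K Q ψ with
  | h0 =>
    have := norm_integral_mul_hermite_le (n := n) fun x => by
      simpa [mixedD_index_zero] using h 0 (fun _ => 1) x
    simpa using this
  | h1 p i ih =>
    have h1 := ih (K := K * (2 * s + c / s)) (Q := Q + 1) (by positivity) (hψ.annihilation i)
      (h.annihilation hK hs hc0 hc hψ.1 i)
    rw [← two_mul_sqrt_mul_integral hψ i (n + p), norm_mul, Complex.norm_of_nonneg (by positivity),
      add_assoc n p] at h1
    have h2 : ρ i ≤ 2 * √((((n + p) i : ℕ) + 1 : ℝ) / 2) := by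
      refine abs_le_of_sq_le_sq' ?_ (by positivity) |>.2
      rw [mul_pow, Real.sq_sqrt (by positivity)]
      have := hρ i
      have h3 : (0 : ℝ) ≤ p i := Nat.cast_nonneg _
      rw [Pi.add_apply]
      push_cast
      linarith
    have h3 : ∏ j, ρ j ^ (p + Pi.single i 1 : Fin d → ℕ) j = (∏ j, ρ j ^ p j) * ρ i := by
      simp only [Pi.add_apply, pow_add, Finset.prod_mul_distrib]
      congr 1
      rw [Finset.prod_eq_single i]
      · simp
      · intro j _ hj; simp [hj]
      · simp
    rw [h3, sum_add_single]
    have h4 : 0 ≤ ∏ j, ρ j ^ p j := Finset.prod_nonneg fun j _ => pow_nonneg (hρ0 j) _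
    have e1 : Q + 1 + (∑ i, p i) + d = Q + ((∑ i, p i) + 1) + d := by ring
    rw [e1] at h1
    calc (∏ j, ρ j ^ p j) * ρ i * ‖∫ x, ψ x * hermite (n + (p + Pi.single i 1)) x‖
        ≤ (∏ j, ρ j ^ p j) * (2 * √((((n + p) i : ℕ) + 1 : ℝ) / 2)) *
          ‖∫ x, ψ x * hermite (n + (p + Pi.single i 1)) x‖ := by gcongr
      _ = (∏ j, ρ j ^ p j) * (2 * √((((n + p) i : ℕ) + 1 : ℝ) / 2) *
          ‖∫ x, ψ x * hermite (n + (p + Pi.single i 1)) x‖) := by ring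
      _ ≤ _ := h1
      _ = _ := by ring

end Decay

section CoefficientDecay

open MeasureTheory

variable {M : WeightSequence} {d : ℕ}

theorem StepSpace.growthBound (hM1 : M.LogConvex) {m : {r : ℝ // 0 < r}} (φ : StepSpace M d m) :
    GrowthBound M ‖φ‖ m.1⁻¹ 0 φ.1 := by
  intro α β x
  have h := StepSpace.le_norm φ (α, β, x)
  rw [weightedTerm_eq] at h
  dsimp only at h
  have hm := m.2
  have ha := M.pos' (∑ i, α i)
  have hb := M.pos' (∑ i, β i)
  rw [div_mul_eq_mul_div, div_le_iff₀ (by positivity)] at h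
  have h1 := hM1.mul_le_add (∑ i, α i) (∑ i, β i)
  rw [zero_add, inv_pow, mul_right_comm, ← div_eq_mul_inv, le_div_iff₀ (by positivity), mul_comm]
  exact h.trans (mul_le_mul_of_nonneg_left h1 (norm_nonneg φ))

theorem StepSpace.rapidDecay (hM1 : M.LogConvex) {m : {r : ℝ // 0 < r}} (φ : StepSpace M d m) :
    RapidDecay φ.1 :=
  ⟨φ.2.1, fun α β => ⟨_, φ.growthBound hM1 α β⟩⟩

/-- The Hermite coefficients of a test function decay like the reciprocal of the associated
function. With `p_i` annihilation operators in the `i`-th variable, one gains `√n_i ^ p_i` as long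
as `2 p_i ≤ n_i`; for the other `p_i` the factor `√n_i ^ p_i` is harmless by (M.3)''. -/
theorem StepSpace.exists_norm_integral_le (hM1 : M.LogConvex) (hM2 : M.Separative)
    (hM3 : M.NonTrivial) (d : ℕ) (m : {r : ℝ // 0 < r}) :
    ∃ θ C : ℝ, 0 < θ ∧ 0 < C ∧ ∀ (φ : StepSpace M d m) (n : Fin d → ℕ),
      ‖∫ x, φ.1 x * hermite n x‖ ≤ C * ‖φ‖ * Real.exp (-∑ i, M.assoc (θ * √(n i))) := by
  obtain ⟨c, hc0, hc⟩ := M.exists_mul_le_add_two hM1 hM3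
  obtain ⟨A, H, hA, hH, hAH⟩ := M.exists_add_le hM2
  obtain ⟨A', H', hA', hH', hAH'⟩ := M.exists_sum_le hM2 d
  obtain ⟨C, L, hC, hL, hCL⟩ := M.exists_sqrt_pow_le hM3
  have hm := m.2
  set s : ℝ := m.1⁻¹ with hs
  have hs0 : 0 < s := inv_pos.2 hm
  set r : ℝ := 2 * s + c / s with hr
  have hr0 : 0 < r := by positivity
  clear_value r
  set J := integralConst d
  have hJ : 0 < J := integralConst_pos d
  have hMd := M.pos' d
  set R₁ : ℝ := r * H * H' with hR₁
  have hR₁0 : 0 < R₁ := by positivity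
  set R : ℝ := R₁ + 2 * L with hR
  have hR0 : 0 < R := by positivity
  set C₁ : ℝ := s ^ d * J * A * H ^ d * M d * A' with hC₁
  have hC₁0 : 0 < C₁ := by positivity
  refine ⟨R⁻¹, 2 ^ d * C₁ * C ^ d, by positivity, by positivity, fun φ n => ?_⟩
  set a := ‖∫ x, φ.1 x * hermite n x‖ with ha
  have ha0 : 0 ≤ a := norm_nonneg _
  have hφ0 := norm_nonneg φ
  have step1 : ∀ p : Fin d → ℕ, (∀ i, 2 * p i ≤ n i) →
      (∏ i, √(n i : ℝ) ^ p i) * a ≤ ‖φ‖ * C₁ * ∏ i, (R₁ ^ p i * M (p i)) := by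
    intro p hp
    have hnp : n - p + p = n := tsub_add_cancel_of_le fun i => by
      have := hp i
      change p i ≤ n i
      omega
    -- since `2 p_i ≤ n_i`, none of the `p_i` factors `2 (n_i - p_i + 1), …` is smaller than `n_i`
    have h1 := (φ.growthBound hM1).prod_pow_mul_norm_integral_le hφ0 hs0 hc0 hc
      (φ.rapidDecay hM1) (n - p) p (fun i => √(n i : ℝ)) (fun i => Real.sqrt_nonneg _) (fun i => by
        rw [Real.sq_sqrt (Nat.cast_nonneg _)]
        have := hp i
        have h2 : n i ≤ 2 * ((n - p) i + 1) := by rw [Pi.sub_apply]; omega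
        exact_mod_cast h2)
    rw [hnp, ← ha, zero_add, ← hr] at h1
    set P := ∑ i, p i with hP
    have hMP := M.pos' P
    calc (∏ i, √(n i : ℝ) ^ p i) * a ≤ ‖φ‖ * r ^ P * s ^ d * M (P + d) * J := h1
      _ ≤ ‖φ‖ * r ^ P * s ^ d * (A * H ^ (P + d) * (M P * M d)) * J := by gcongr; exact hAH P d
      _ ≤ ‖φ‖ * r ^ P * s ^ d * (A * H ^ (P + d) * ((A' * H' ^ P * ∏ i, M (p i)) * M d)) * J := by
        gcongr; exact hAH' p
      _ = ‖φ‖ * C₁ * ∏ i, (R₁ ^ p i * M (p i)) := by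
        rw [Finset.prod_mul_distrib, Finset.prod_pow_eq_pow_sum, ← hP, hR₁, hC₁]; ring
  have step2 : ∀ p : Fin d → ℕ, (∏ i, √(n i : ℝ) ^ p i) * a ≤
      ‖φ‖ * C₁ * C ^ d * ∏ i, (R ^ p i * M (p i)) := by
    intro p
    -- `p'` is `p i` or, if that is too large, `0`; the factor `t` makes up for the difference
    have hex : ∀ i, ∃ (p' : ℕ) (t : ℝ), 0 < t ∧ 2 * p' ≤ n i ∧
        √(n i : ℝ) ^ p i ≤ √(n i : ℝ) ^ p' * t ∧
        R₁ ^ p' * M p' * t ≤ C * (R ^ p i * M (p i)) := by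
      intro i
      have hMp := M.pos' (p i)
      rcases le_or_gt (2 * p i) (n i) with h | h
      · refine ⟨p i, 1, one_pos, h, by simp, ?_⟩
        rw [mul_one]
        calc R₁ ^ p i * M (p i) ≤ R ^ p i * M (p i) := by
              gcongr
              linarith
          _ ≤ _ := le_mul_of_one_le_left (by positivity) hC
      · refine ⟨0, 2 ^ p i * (C * L ^ p i * M (p i)), by positivity, by omega, ?_, ?_⟩
        · have h2 : √(n i : ℝ) ≤ 2 * √(p i : ℝ) := by
            rw [Real.sqrt_le_left (by positivity), mul_pow, Real.sq_sqrt (Nat.cast_nonneg _)]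
            have : n i ≤ 4 * p i := by omega
            have h3 : (n i : ℝ) ≤ 4 * p i := by exact_mod_cast this
            linarith
          rw [pow_zero, one_mul]
          calc √(n i : ℝ) ^ p i ≤ (2 * √(p i : ℝ)) ^ p i := by gcongr
            _ = 2 ^ p i * √(p i : ℝ) ^ p i := mul_pow _ _ _
            _ ≤ _ := by gcongr; exact hCL _
        · rw [pow_zero, M.zero', one_mul, one_mul]
          calc 2 ^ p i * (C * L ^ p i * M (p i)) = C * ((2 * L) ^ p i * M (p i)) := by
                rw [mul_pow]; ring
            _ ≤ _ := by
                gcongr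
                linarith
    choose p' t ht hp' h1 h2 using hex
    have hT : 0 ≤ ∏ i, t i := Finset.prod_nonneg fun i _ => (ht i).le
    calc (∏ i, √(n i : ℝ) ^ p i) * a ≤ (∏ i, (√(n i : ℝ) ^ p' i * t i)) * a := by
          gcongr with i; exact h1 i
      _ = (∏ i, t i) * ((∏ i, √(n i : ℝ) ^ p' i) * a) := by
          rw [Finset.prod_mul_distrib]; ring
      _ ≤ (∏ i, t i) * (‖φ‖ * C₁ * ∏ i, (R₁ ^ p' i * M (p' i))) := by
          exact mul_le_mul_of_nonneg_left (step1 p' hp') hT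
      _ = ‖φ‖ * C₁ * ∏ i, (R₁ ^ p' i * M (p' i) * t i) := by
          rw [Finset.prod_mul_distrib (f := fun i => R₁ ^ p' i * M (p' i))]; ring
      _ ≤ ‖φ‖ * C₁ * ∏ i, (C * (R ^ p i * M (p i))) := by
          refine mul_le_mul_of_nonneg_left (Finset.prod_le_prod (fun i _ => ?_) fun i _ => h2 i)
            (by positivity)
          have := M.pos' (p' i)
          have := ht i
          positivity
      _ = _ := by
          rw [Finset.prod_mul_distrib, Finset.prod_const, Finset.card_univ, Fintype.card_fin]
          ring
  choose p hp using fun i => M.exists_exp_assoc_mul_le (ρ := R⁻¹ * √(n i : ℝ)) (by positivity)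
  have hQ : 0 < ∏ i, (R ^ p i * M (p i)) :=
    Finset.prod_pos fun i _ => mul_pos (pow_pos hR0 _) (M.pos' _)
  have h3 : Real.exp (∑ i, M.assoc (R⁻¹ * √(n i : ℝ))) * ∏ i, (R ^ p i * M (p i)) ≤
      2 ^ d * ∏ i, √(n i : ℝ) ^ p i := by
    rw [Real.exp_sum, ← Finset.prod_mul_distrib]
    calc ∏ i, (Real.exp (M.assoc (R⁻¹ * √(n i : ℝ))) * (R ^ p i * M (p i)))
        ≤ ∏ i, (2 * √(n i : ℝ) ^ p i) := by
          refine Finset.prod_le_prod (fun i _ => ?_) fun i _ => ?_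
          · have := M.pos' (p i); positivity
          · calc Real.exp (M.assoc (R⁻¹ * √(n i : ℝ))) * (R ^ p i * M (p i))
                = R ^ p i * (Real.exp (M.assoc (R⁻¹ * √(n i : ℝ))) * M (p i)) := by ring
              _ ≤ R ^ p i * (2 * (R⁻¹ * √(n i : ℝ)) ^ p i) :=
                mul_le_mul_of_nonneg_left (hp i) (by positivity)
              _ = 2 * √(n i : ℝ) ^ p i := by
                rw [mul_pow, inv_pow]; field_simp
      _ = _ := by rw [Finset.prod_mul_distrib]; simp
  rw [Real.exp_neg, ← div_eq_mul_inv, le_div_iff₀ (Real.exp_pos _)]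
  refine le_of_mul_le_mul_right ?_ hQ
  calc a * Real.exp (∑ i, M.assoc (R⁻¹ * √(n i : ℝ))) * ∏ i, (R ^ p i * M (p i))
      = a * (Real.exp (∑ i, M.assoc (R⁻¹ * √(n i : ℝ))) * ∏ i, (R ^ p i * M (p i))) := by ring
    _ ≤ a * (2 ^ d * ∏ i, √(n i : ℝ) ^ p i) := by gcongr
    _ = 2 ^ d * ((∏ i, √(n i : ℝ) ^ p i) * a) := by ring
    _ ≤ 2 ^ d * (‖φ‖ * C₁ * C ^ d * ∏ i, (R ^ p i * M (p i))) :=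
      mul_le_mul_of_nonneg_left (step2 p) (by positivity)
    _ = _ := by ring

end CoefficientDecay

/-! ### Completeness of the Hermite functions -/

section Completeness

open MeasureTheory

variable {d : ℕ} {φ ψ : EuclideanSpace ℝ (Fin d) → ℂ}

/-- The finite linear combinations of Hermite functions. -/
def hermiteSpan (d : ℕ) : Submodule ℂ (EuclideanSpace ℝ (Fin d) → ℂ) :=
  Submodule.span ℂ (Set.range hermite)

theorem hermite_mem_hermiteSpan (n : Fin d → ℕ) : hermite n ∈ hermiteSpan d :=
  Submodule.subset_span ⟨n, rfl⟩

theorem rapidDecay_of_mem_hermiteSpan (hψ : ψ ∈ hermiteSpan d) : RapidDecay ψ := by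
  induction hψ using Submodule.span_induction with
  | mem x hx => obtain ⟨n, rfl⟩ := hx; exact rapidDecay_hermite n
  | zero => simpa using (rapidDecay_hermite (0 : Fin d → ℕ)).const_smul 0
  | add x y _ _ hx hy => exact hx.add hy
  | smul c x _ hx => exact hx.const_smul c

theorem coordMul_mem_hermiteSpan (hψ : ψ ∈ hermiteSpan d) (i : Fin d) :
    coordMul i ψ ∈ hermiteSpan d := by
  induction hψ using Submodule.span_induction with
  | mem x hx =>
    obtain ⟨n, rfl⟩ := hx
    rw [coordMul_hermite]
    exact add_mem (Submodule.smul_mem _ _ (hermite_mem_hermiteSpan _))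
      (Submodule.smul_mem _ _ (hermite_mem_hermiteSpan _))
  | zero =>
    have : coordMul i (0 : EuclideanSpace ℝ (Fin d) → ℂ) = 0 := by funext; simp [coordMul]
    rw [this]; exact zero_mem _
  | add x y _ _ hx hy =>
    have : coordMul i (x + y) = coordMul i x + coordMul i y := by
      funext; simp [coordMul, mul_add]
    rw [this]; exact add_mem hx hy
  | smul c x _ hx =>
    have : coordMul i (c • x) = c • coordMul i x := by
      funext; simp [coordMul, mul_left_comm]
    rw [this]; exact Submodule.smul_mem _ c hx

theorem mixedD_mem_hermiteSpan (hψ : ψ ∈ hermiteSpan d) (α : Fin d → ℕ) :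
    mixedD α ψ ∈ hermiteSpan d := by
  induction α using pi_induction generalizing ψ with
  | h0 => rwa [mixedD_index_zero]
  | h1 α i ih =>
    rw [← mixedD_partialD α i (rapidDecay_of_mem_hermiteSpan hψ).1]
    refine ih ?_
    induction hψ using Submodule.span_induction with
    | mem x hx =>
      obtain ⟨n, rfl⟩ := hx
      rw [partialD_hermite]
      exact add_mem (Submodule.smul_mem _ _ (hermite_mem_hermiteSpan _))
        (Submodule.smul_mem _ _ (hermite_mem_hermiteSpan _))
    | zero =>
      have : partialD i (0 : EuclideanSpace ℝ (Fin d) → ℂ) = 0 := by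
        funext x; simp [partialD]
      rw [this]; exact zero_mem _
    | add x y hx' hy' hx hy =>
      have := partialD_linear i 1 (rapidDecay_of_mem_hermiteSpan hx').1
        (rapidDecay_of_mem_hermiteSpan hy').1
      rw [one_smul, one_smul] at this
      rw [this]; exact add_mem hx hy
    | smul c x hx' hx =>
      have := partialD_linear i c (rapidDecay_of_mem_hermiteSpan hx').1
        (rapidDecay_of_mem_hermiteSpan (zero_mem (hermiteSpan d))).1
      have h0 : partialD i (0 : EuclideanSpace ℝ (Fin d) → ℂ) = 0 := by
        funext x; simp [partialD]
      rw [add_zero, h0, add_zero] at this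
      rw [this]; exact Submodule.smul_mem _ c hx

theorem inner_pow_mul_mem_hermiteSpan (hψ : ψ ∈ hermiteSpan d) (ξ : EuclideanSpace ℝ (Fin d))
    (k : ℕ) : (fun x => ((inner ℝ x ξ : ℝ) : ℂ) ^ k * ψ x) ∈ hermiteSpan d := by
  induction k with
  | zero => simpa using hψ
  | succ k ih =>
    have : (fun x => ((inner ℝ x ξ : ℝ) : ℂ) ^ (k + 1) * ψ x) =
        ∑ i, (ξ i : ℂ) • coordMul i (fun x => ((inner ℝ x ξ : ℝ) : ℂ) ^ k * ψ x) := by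
      funext x
      have h1 : ((inner ℝ x ξ : ℝ) : ℂ) = ∑ i, (ξ i : ℂ) * (x i : ℂ) := by
        rw [PiLp.inner_apply]; simp
      rw [pow_succ', mul_assoc]
      nth_rw 1 [h1]
      simp only [Finset.sum_apply, Pi.smul_apply, smul_eq_mul, coordMul, Finset.sum_mul, mul_assoc]
    rw [this]
    exact sum_mem fun i _ => Submodule.smul_mem _ _ (coordMul_mem_hermiteSpan ih i)

theorem norm_hermite_zero (x : EuclideanSpace ℝ (Fin d)) :
    ‖hermite 0 x‖ = (Real.pi ^ (-(1 / 4 : ℝ))) ^ d * Real.exp (-(‖x‖ ^ 2 / 2)) := by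
  rw [hermite, Complex.norm_real, Real.norm_eq_abs, Finset.abs_prod, EuclideanSpace.norm_sq_eq,
    Finset.sum_div, ← Finset.sum_neg_distrib, Real.exp_sum]
  have : ∀ i, |hermite1 ((0 : Fin d → ℕ) i) (x i)| =
      Real.pi ^ (-(1 / 4 : ℝ)) * Real.exp (-(‖x i‖ ^ 2 / 2)) := by
    intro i
    have hpi : 0 < Real.pi ^ (-(1 / 4 : ℝ)) := Real.rpow_pos_of_pos Real.pi_pos _
    rw [Pi.zero_apply, hermite1_zero, abs_mul, abs_of_pos hpi, abs_of_pos (Real.exp_pos _),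
      Real.norm_eq_abs, sq_abs]
  simp only [this, Finset.prod_mul_distrib]
  simp

/-- A bounded continuous function whose Hermite coefficients all vanish is zero. Its product `G`
with the Gaussian `hermite 0` is orthogonal to all polynomials, so expanding the exponential shows
that the Fourier transform of `G` vanishes. -/
theorem eq_zero_of_integral_mul_hermite_eq_zero {g : EuclideanSpace ℝ (Fin d) → ℂ}
    (hg : Continuous g) {B : ℝ} (hB : ∀ x, ‖g x‖ ≤ B)
    (h : ∀ n : Fin d → ℕ, ∫ x, g x * hermite n x = 0) : g = 0 := by
  have hspan : ∀ ψ ∈ hermiteSpan d, ∫ x, g x * ψ x = 0 := by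
    intro ψ hψ
    induction hψ using Submodule.span_induction with
    | mem x hx => obtain ⟨n, rfl⟩ := hx; exact h n
    | zero => simp
    | add x y hx' hy' hx hy =>
      simp only [Pi.add_apply, mul_add]
      rw [integral_add ((rapidDecay_of_mem_hermiteSpan hx').integrable_mul hg ⟨B, hB⟩)
        ((rapidDecay_of_mem_hermiteSpan hy').integrable_mul hg ⟨B, hB⟩), hx, hy, add_zero]
    | smul c x _ hx =>
      simp only [Pi.smul_apply, smul_eq_mul, mul_left_comm _ c]
      rw [integral_const_mul, hx, mul_zero]
  set G : EuclideanSpace ℝ (Fin d) → ℂ := fun x => g x * hermite 0 x with hG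
  have hH0 := rapidDecay_hermite (0 : Fin d → ℕ)
  have hGc : Continuous G := hg.mul hH0.1.continuous
  have hGi : Integrable G := hH0.integrable_mul hg ⟨B, hB⟩
  have hF : FourierTransform.fourier G = 0 := by
    funext ξ
    rw [Real.fourier_eq']
    set T : ℝ := 2 * Real.pi * ‖ξ‖ with hT
    have hT0 : 0 ≤ T := by positivity
    have hsum : HasSum (fun k : ℕ => ∫ x, ((((-2 * Real.pi * inner ℝ x ξ : ℝ) : ℂ) * Complex.I) ^ k /
        (k.factorial : ℂ)) • G x)
        (∫ x, Complex.exp (((-2 * Real.pi * inner ℝ x ξ : ℝ) : ℂ) * Complex.I) • G x) := by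
      have hexp : ∀ x, HasSum (fun k : ℕ => (T * ‖x‖) ^ k / (k.factorial : ℝ) * ‖G x‖)
          (Real.exp (T * ‖x‖) * ‖G x‖) := by
        intro x
        have := NormedSpace.expSeries_div_hasSum_exp (T * ‖x‖)
        rw [← Real.exp_eq_exp_ℝ] at this
        exact this.mul_right _
      refine hasSum_integral_of_dominated_convergence
        (fun k x => (T * ‖x‖) ^ k / (k.factorial : ℝ) * ‖G x‖) (fun k => ?_) (fun k => ?_)
        (Filter.Eventually.of_forall fun x => (hexp x).summable) ?_
        (Filter.Eventually.of_forall fun x => ?_)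
      · refine Continuous.aestronglyMeasurable ?_
        fun_prop
      · refine Filter.Eventually.of_forall fun x => ?_
        rw [norm_smul, norm_div, norm_pow, norm_mul, Complex.norm_I, mul_one, Complex.norm_natCast,
          Complex.norm_real]
        gcongr
        rw [norm_mul, hT, norm_mul]
        have h1 := norm_inner_le_norm (𝕜 := ℝ) x ξ
        have h2 : ‖(-2 : ℝ)‖ = 2 := by norm_num
        have h3 : ‖Real.pi‖ = Real.pi := by rw [Real.norm_eq_abs, abs_of_pos Real.pi_pos]
        rw [h2, h3]
        have := Real.pi_pos
        nlinarith
      · simp only [fun x => (hexp x).tsum_eq]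
        have hgauss : Integrable fun x : EuclideanSpace ℝ (Fin d) =>
            Real.exp (-(1 / 4) * ‖x‖ ^ 2) := by
          have := (GaussianFourier.integrable_cexp_neg_mul_sq_norm_add
            (V := EuclideanSpace ℝ (Fin d)) (b := 1 / 4) (by norm_num) 0 0).norm
          refine this.congr (Filter.Eventually.of_forall fun x => ?_)
          simp only [Complex.norm_exp]
          congr 1
          rw [zero_mul, add_zero]
          have : (-(1 / 4) * (‖x‖ : ℂ) ^ 2) = ((-(1 / 4) * ‖x‖ ^ 2 : ℝ) : ℂ) := by push_cast; ring
          rw [this, Complex.ofReal_re]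
        refine (hgauss.const_mul (B * (Real.pi ^ (-(1 / 4 : ℝ))) ^ d * Real.exp (T ^ 2))).mono'
          (by fun_prop) (Filter.Eventually.of_forall fun x => ?_)
        have hpi : 0 < Real.pi ^ (-(1 / 4 : ℝ)) := Real.rpow_pos_of_pos Real.pi_pos _
        rw [norm_mul, norm_norm, Real.norm_eq_abs, abs_of_pos (Real.exp_pos _), hG, norm_mul,
          norm_hermite_zero]
        have hB0 : 0 ≤ B := (norm_nonneg _).trans (hB 0)
        calc Real.exp (T * ‖x‖) * (‖g x‖ * ((Real.pi ^ (-(1 / 4 : ℝ))) ^ d *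
              Real.exp (-(‖x‖ ^ 2 / 2))))
            ≤ Real.exp (T * ‖x‖) * (B * ((Real.pi ^ (-(1 / 4 : ℝ))) ^ d *
              Real.exp (-(‖x‖ ^ 2 / 2)))) := by gcongr; exact hB x
          _ = B * (Real.pi ^ (-(1 / 4 : ℝ))) ^ d *
              Real.exp (T * ‖x‖ - ‖x‖ ^ 2 / 2) := by rw [sub_eq_add_neg, Real.exp_add]; ring
          _ ≤ B * (Real.pi ^ (-(1 / 4 : ℝ))) ^ d * Real.exp (T ^ 2 + -(1 / 4) * ‖x‖ ^ 2) := by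
              gcongr
              nlinarith [sq_nonneg (T - ‖x‖ / 2)]
          _ = _ := by rw [Real.exp_add]; ring
      · have := NormedSpace.expSeries_div_hasSum_exp
          (((-2 * Real.pi * inner ℝ x ξ : ℝ) : ℂ) * Complex.I)
        rw [← Complex.exp_eq_exp_ℂ] at this
        exact this.smul_const _
    have hzero : ∀ k : ℕ, ∫ x, ((((-2 * Real.pi * inner ℝ x ξ : ℝ) : ℂ) * Complex.I) ^ k /
        (k.factorial : ℂ)) • G x = 0 := by
      intro k
      have h1 := hspan _ (inner_pow_mul_mem_hermiteSpan
        (hermite_mem_hermiteSpan (0 : Fin d → ℕ)) ξ k)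
      have h2 : ∀ x, ((((-2 * Real.pi * inner ℝ x ξ : ℝ) : ℂ) * Complex.I) ^ k /
          (k.factorial : ℂ)) • G x = ((-2 * Real.pi : ℂ) * Complex.I) ^ k / (k.factorial : ℂ) *
            (g x * (((inner ℝ x ξ : ℝ) : ℂ) ^ k * hermite 0 x)) := by
        intro x
        rw [hG, smul_eq_mul]
        push_cast
        ring
      simp only [h2]
      rw [integral_const_mul, h1, mul_zero]
    simp only [hzero] at hsum
    exact hsum.unique hasSum_zero
  have hG0 : G = 0 := by
    have h1 := hGc.fourierInv_fourier_eq hGi (by rw [hF]; exact integrable_zero _ _ _)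
    rw [← h1, hF]
    funext x
    simp [Real.fourierInv_eq']
  funext x
  have h1 := congrFun hG0 x
  have h2 : hermite 0 x ≠ 0 := by
    rw [← norm_pos_iff, norm_hermite_zero]
    have hpi : 0 < Real.pi ^ (-(1 / 4 : ℝ)) := Real.rpow_pos_of_pos Real.pi_pos _
    positivity
  exact (mul_eq_zero.1 h1).resolve_right h2

theorem hasSum_integral_mul_of_mem_hermiteSpan (hφ : RapidDecay φ) (hψ : ψ ∈ hermiteSpan d) :
    HasSum (fun k : Fin d → ℕ => (∫ x, φ x * hermite k x) * ∫ x, hermite k x * ψ x)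
      (∫ x, φ x * ψ x) := by
  induction hψ using Submodule.span_induction with
  | mem x hx =>
    obtain ⟨n, rfl⟩ := hx
    simp only [integral_hermite_mul]
    have := hasSum_single (f := fun k : Fin d → ℕ =>
      (∫ x, φ x * hermite k x) * if k = n then 1 else 0) n (fun k hk => by simp [hk])
    simpa using this
  | zero => simp
  | add x y hx' hy' hx hy =>
    have hx'' := rapidDecay_of_mem_hermiteSpan hx'
    have hy'' := rapidDecay_of_mem_hermiteSpan hy'
    have e : ∀ θ : EuclideanSpace ℝ (Fin d) → ℂ, RapidDecay θ →
        ∫ t, θ t * (x + y) t = (∫ t, θ t * x t) + ∫ t, θ t * y t := by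
      intro θ hθ
      rw [← integral_add (hθ.integrable_mul' hx'') (hθ.integrable_mul' hy'')]
      simp only [Pi.add_apply, mul_add]
    rw [e φ hφ]
    simp only [e _ (rapidDecay_hermite _), mul_add]
    exact hx.add hy
  | smul c x _ hx =>
    have e : ∀ θ : EuclideanSpace ℝ (Fin d) → ℂ,
        ∫ t, θ t * (c • x) t = c * ∫ t, θ t * x t := by
      intro θ
      rw [← integral_const_mul]
      simp only [Pi.smul_apply, smul_eq_mul, mul_left_comm _ c]
    simp only [e, mul_left_comm _ c]
    exact hx.mul_left c

/-- The Hermite expansion may be differentiated term by term, as soon as the differentiated series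
converges normally. By integration by parts both sides have the same Hermite coefficients. -/
theorem RapidDecay.hasSum_mixedD (hφ : RapidDecay φ) (α : Fin d → ℕ) {S : (Fin d → ℕ) → ℝ}
    (hS : ∀ n x, ‖GelfandShilov.mixedD α (hermite n) x‖ ≤ S n)
    (hsum : Summable fun n : Fin d → ℕ => ‖∫ x, φ x * hermite n x‖ * S n)
    (x : EuclideanSpace ℝ (Fin d)) :
    HasSum (fun n : Fin d → ℕ => (∫ y, φ y * hermite n y) * GelfandShilov.mixedD α (hermite n) x)
      (GelfandShilov.mixedD α φ x) := by
  set a : (Fin d → ℕ) → ℂ := fun n => ∫ y, φ y * hermite n y with ha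
  have hle : ∀ n y, ‖a n * GelfandShilov.mixedD α (hermite n) y‖ ≤ ‖a n‖ * S n := fun n y => by
    rw [norm_mul]; exact mul_le_mul_of_nonneg_left (hS n y) (norm_nonneg _)
  have hsummable : ∀ y, Summable fun n => a n * GelfandShilov.mixedD α (hermite n) y := fun y =>
    Summable.of_norm_bounded hsum fun n => hle n y
  set T : EuclideanSpace ℝ (Fin d) → ℂ :=
    fun y => ∑' n, a n * GelfandShilov.mixedD α (hermite n) y with hT
  have hTc : Continuous T := continuous_tsum
    (fun n => continuous_const.mul (contDiff_mixedD α (contDiff_hermite n)).continuous) hsum hle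
  have hTb : ∀ y, ‖T y‖ ≤ ∑' n, ‖a n‖ * S n := fun y =>
    tsum_of_norm_bounded hsum.hasSum fun n => hle n y
  obtain ⟨B, hB⟩ := (hφ.mixedD α).bounded
  have hcoeff : ∀ n, ∫ y, T y * hermite n y = ∫ y, GelfandShilov.mixedD α φ y * hermite n y := by
    intro n
    have hint : ∀ k, Integrable fun y =>
        (a k * GelfandShilov.mixedD α (hermite k) y) * hermite n y := fun k => by
      simp only [mul_assoc]
      exact (((rapidDecay_hermite k).mixedD α).integrable_mul' (rapidDecay_hermite n)).const_mul _
    have hnint := (rapidDecay_hermite n).integrable.norm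
    have h1 := hasSum_integral_of_summable_integral_norm hint (by
      refine Summable.of_nonneg_of_le (fun k => integral_nonneg fun _ => norm_nonneg _) (fun k => ?_)
        (hsum.mul_right (∫ y, ‖hermite n y‖))
      rw [← integral_const_mul]
      refine integral_mono (hint k).norm (hnint.const_mul _) fun y => ?_
      dsimp only
      rw [norm_mul]
      exact mul_le_mul_of_nonneg_right (hle k y) (norm_nonneg _))
    simp only [tsum_mul_right] at h1
    have h2 := (hasSum_integral_mul_of_mem_hermiteSpan hφ
      (mixedD_mem_hermiteSpan (hermite_mem_hermiteSpan n) α)).mul_left ((-1 : ℂ) ^ (∑ i, α i))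
    rw [← hφ.integral_mul_mixedD (rapidDecay_hermite n)] at h2
    refine h1.unique (h2.congr_fun ?_)
    intro k
    simp only [mul_assoc]
    rw [integral_const_mul, (rapidDecay_hermite k).integral_mul_mixedD (rapidDecay_hermite n)]
    ring
  have hzero := eq_zero_of_integral_mul_hermite_eq_zero
    (g := fun y => GelfandShilov.mixedD α φ y - T y)
    ((hφ.mixedD α).1.continuous.sub hTc) (B := B + ∑' n, ‖a n‖ * S n)
    (fun y => (norm_sub_le _ _).trans (add_le_add (hB y) (hTb y))) (fun n => by
      simp only [sub_mul]
      rw [integral_sub ((hφ.mixedD α).integrable_mul' (rapidDecay_hermite n))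
        ((rapidDecay_hermite n).integrable_mul hTc ⟨_, hTb⟩), hcoeff n, sub_self])
  have h3 : GelfandShilov.mixedD α φ x = T x := sub_eq_zero.1 (congrFun hzero x)
  rw [h3]
  exact (hsummable x).hasSum

end Completeness

/-! ### Convergence of Hermite expansions and the inductive limit topology -/

section Expansion

open MeasureTheory

variable {M : WeightSequence} {d : ℕ}

namespace StepSpace

variable {m : {r : ℝ // 0 < r}}

/-- A function in `stepSubmodule M d m` as an element of the normed space `StepSpace M d m`. -/
def mk (φ : EuclideanSpace ℝ (Fin d) → ℂ) (h : φ ∈ stepSubmodule M d m) : StepSpace M d m := ⟨φ, h⟩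

/-- The evaluation `φ ↦ m^(|α|+|β|) / (M_|α| M_|β|) (1+x²)^(β/2) φ^(α)(x)`, whose absolute value is
`weightedTerm M m φ (α, β, x)`. -/
def weightedEval (q : (Fin d → ℕ) × (Fin d → ℕ) × EuclideanSpace ℝ (Fin d)) :
    StepSpace M d m →ₗ[ℂ] ℂ where
  toFun φ := ((m.1 ^ ((∑ i, q.1 i) + ∑ i, q.2.1 i) / (M (∑ i, q.1 i) * M (∑ i, q.2.1 i)) *
    wt q.2.1 q.2.2 : ℝ) : ℂ) * mixedD q.1 φ.1 q.2.2
  map_add' φ ψ := by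
    have h : mixedD q.1 (φ + ψ).1 = mixedD q.1 φ.1 + mixedD q.1 ψ.1 := mixedD_add _ φ.2.1 ψ.2.1
    rw [h, Pi.add_apply, mul_add]
  map_smul' c φ := by
    have h : mixedD q.1 (c • φ).1 = c • mixedD q.1 φ.1 := mixedD_smul _ c φ.2.1
    rw [h, Pi.smul_apply, smul_eq_mul, RingHom.id_apply, smul_eq_mul, mul_left_comm]

theorem weightedEval_apply (q : (Fin d → ℕ) × (Fin d → ℕ) × EuclideanSpace ℝ (Fin d))
    (φ : StepSpace M d m) : weightedEval q φ =
      ((m.1 ^ ((∑ i, q.1 i) + ∑ i, q.2.1 i) / (M (∑ i, q.1 i) * M (∑ i, q.2.1 i)) *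
        wt q.2.1 q.2.2 : ℝ) : ℂ) * mixedD q.1 φ.1 q.2.2 := rfl

theorem norm_weightedEval (q : (Fin d → ℕ) × (Fin d → ℕ) × EuclideanSpace ℝ (Fin d))
    (φ : StepSpace M d m) : ‖weightedEval q φ‖ = weightedTerm M m.1 φ.1 q := by
  rw [weightedEval_apply, weightedTerm_eq, norm_mul, Complex.norm_of_nonneg, mul_assoc]
  exact mul_nonneg (weight_nonneg M m.2 _ _) (wt_pos _ _).le

/-- An absolutely convergent series converges in the step to `φ` as soon as all differentiated series
converge pointwise to the derivatives of `φ`. As the limit is given, completeness of the step is not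
needed. -/
theorem hasSum_of_mixedD {ι : Type*} {v : ι → StepSpace M d m} {φ : StepSpace M d m}
    (hv : Summable fun k => ‖v k‖)
    (h : ∀ (α : Fin d → ℕ) x, HasSum (fun k => mixedD α (v k).1 x) (mixedD α φ.1 x)) :
    HasSum v φ := by
  rw [HasSum, SummationFilter.unconditional_filter, tendsto_iff_norm_sub_tendsto_zero]
  refine squeeze_zero (fun _ => norm_nonneg _) (fun s => ?_)
    (tendsto_tsum_compl_atTop_zero fun k => ‖v k‖)
  rw [norm_sub_rev, norm_def]
  refine ciSup_le fun q => ?_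
  rw [← norm_weightedEval, map_sub, map_sum]
  have h1 : HasSum (fun k => weightedEval q (v k)) (weightedEval q φ) :=
    (h q.1 q.2.2).mul_left _
  have h2 : HasSum ((fun k => weightedEval q (v k)) ∘ ((↑) : {k // k ∉ s} → ι))
      (weightedEval q φ - ∑ k ∈ s, weightedEval q (v k)) := by
    refine (Finset.hasSum_compl_iff (f := fun k => weightedEval q (v k)) s).2 ?_
    rwa [sub_add_cancel]
  refine h2.norm_le_of_bounded (hv.subtype _).hasSum fun k => ?_
  rw [Function.comp_apply, norm_weightedEval]
  exact le_norm _ q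

end StepSpace

theorem exists_hermite_mem_stepSubmodule (hM1 : M.LogConvex) (hM2 : M.Separative)
    (hM3 : M.NonTrivial) (d : ℕ) {θ : ℝ} (hθ : 0 < θ) :
    ∃ m : {r : ℝ // 0 < r}, ∃ C : ℝ, 0 < C ∧ ∀ m' : {r : ℝ // 0 < r}, m'.1 ≤ m.1 →
      ∀ n : Fin d → ℕ, ∃ h : hermite n ∈ stepSubmodule M d m',
        ‖StepSpace.mk (hermite n) h‖ ≤
          C * Real.exp (∑ i, M.assoc (θ * √(n i))) := by
  obtain ⟨m, C, hC, h⟩ := exists_weightedTerm_hermite_le hM1 hM2 hM3 d hθ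
  refine ⟨m, C, hC, fun m' hm' n => ?_⟩
  have h' : ∀ q, weightedTerm M m'.1 (hermite n) q ≤ C * Real.exp (∑ i, M.assoc (θ * √(n i))) :=
    fun q => (weightedTerm_mono M m'.2 hm' _ q).trans (h n q)
  have hmem : hermite n ∈ stepSubmodule M d m' :=
    ⟨contDiff_hermite n, _, by rintro _ ⟨q, rfl⟩; exact h' q⟩
  exact ⟨hmem, ciSup_le h'⟩

/-- The Hermite expansion of a test function converges in the norm of some step, in general with a
smaller `m` than the step the function was given in. -/
theorem exists_hasSum_hermite (hM1 : M.LogConvex) (hM2 : M.Separative) (hM3 : M.NonTrivial)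
    {m : {r : ℝ // 0 < r}} (φ : StepSpace M d m) :
    ∃ (m' : {r : ℝ // 0 < r}) (hφ : φ.1 ∈ stepSubmodule M d m')
      (hH : ∀ n : Fin d → ℕ, hermite n ∈ stepSubmodule M d m'),
      HasSum (fun n => (∫ x, φ.1 x * hermite n x) • StepSpace.mk (hermite n) (hH n))
        (StepSpace.mk φ.1 hφ) := by
  obtain ⟨θ, C, hθ, hC, hdecay⟩ := StepSpace.exists_norm_integral_le hM1 hM2 hM3 d m
  obtain ⟨θ', hθ', hsum⟩ := exists_summable_exp_assoc hM2 hM3 d hθ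
  obtain ⟨m₁, C₁, hC₁, hH⟩ := exists_hermite_mem_stepSubmodule hM1 hM2 hM3 d hθ'
  set m' : {r : ℝ // 0 < r} := ⟨min m.1 m₁.1, lt_min m.2 m₁.2⟩ with hm'
  choose hmem hnorm using hH m' (min_le_right _ _)
  refine ⟨m', stepSubmodule_anti M d (min_le_left m.1 m₁.1) φ.2, hmem, ?_⟩
  have hs : Summable fun n : Fin d → ℕ => ‖∫ x, φ.1 x * hermite n x‖ *
      ‖StepSpace.mk (hermite n) (hmem n)‖ := by
    refine Summable.of_nonneg_of_le (fun n => by positivity) (fun n => ?_)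
      (hsum.mul_left (C * ‖φ‖ * C₁))
    calc _ ≤ C * ‖φ‖ * Real.exp (-∑ i, M.assoc (θ * √(n i))) *
          (C₁ * Real.exp (∑ i, M.assoc (θ' * √(n i)))) :=
          mul_le_mul (hdecay φ n) (hnorm n) (norm_nonneg _) (by positivity)
      _ = _ := by ring
  refine StepSpace.hasSum_of_mixedD (by simpa only [norm_smul] using hs) fun α x => ?_
  set A := ∑ i, α i
  have hMA := M.pos' A
  have hm0 := m'.2
  have hS : ∀ (n : Fin d → ℕ) y, ‖mixedD α (hermite n) y‖ ≤
      M A / m'.1 ^ A * ‖StepSpace.mk (hermite n) (hmem n)‖ := by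
    intro n y
    have h1 := StepSpace.le_norm (StepSpace.mk (hermite n) (hmem n)) (α, 0, y)
    rw [weightedTerm_eq] at h1
    simp only [wt_zero, one_mul, Pi.zero_apply, Finset.sum_const_zero, add_zero, M.zero',
      mul_one] at h1
    calc ‖mixedD α (hermite n) y‖
        = M A / m'.1 ^ A * (m'.1 ^ A / M A * ‖mixedD α (hermite n) y‖) := by field_simp
      _ ≤ _ := mul_le_mul_of_nonneg_left h1 (by positivity)
  have h2 := (φ.rapidDecay hM1).hasSum_mixedD α hS (by
    refine (hs.mul_left (M A / m'.1 ^ A)).congr fun n => ?_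
    ring) x
  refine h2.congr_fun fun n => ?_
  have h3 : ∀ c : ℂ, (c • StepSpace.mk (hermite n) (hmem n)).1 = c • hermite n :=
    fun c => rfl
  rw [h3, mixedD_smul _ _ (contDiff_hermite n)]
  rfl

namespace Space

theorem continuous_ofStep (m : {r : ℝ // 0 < r}) :
    Continuous (ofStep m : StepSpace M d m →ₗ[ℂ] Space M d) :=
  continuous_sInf_rng.2 fun _ ht => ht.1 m

/-- The universal property of the inductive limit topology, for linear functionals. -/
theorem continuous_of_comp_ofStep (f : Space M d →ₗ[ℂ] ℂ)
    (h : ∀ m, Continuous fun φ : StepSpace M d m => f (ofStep m φ)) : Continuous f := by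
  rw [continuous_iff_le_induced]
  refine sInf_le ⟨fun m => continuous_induced_rng.2 (h m), topologicalAddGroup_induced f,
    continuousSMul_induced f, ?_⟩
  exact LocallyConvexSpace.induced (f.restrictScalars ℝ)

/-- The restriction of a continuous linear functional to a step. -/
def restrict (f : Space M d →L[ℂ] ℂ) (m : {r : ℝ // 0 < r}) : StepSpace M d m →L[ℂ] ℂ :=
  ⟨f.toLinearMap.comp (ofStep m), f.continuous.comp (continuous_ofStep m)⟩

theorem exists_eq_ofStep (φ : Space M d) : ∃ m, ∃ ψ : StepSpace M d m, φ = ofStep m ψ :=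
  ⟨φ.2.choose, ⟨φ.1, φ.2.choose_spec⟩, rfl⟩

end Space

theorem coeff_ofStep {m : {r : ℝ // 0 < r}} (n : Fin d → ℕ) (φ : StepSpace M d m) :
    coeff n (Space.ofStep m φ) = ∫ x, φ.1 x * hermite n x := rfl

theorem coeff_linear (hM1 : M.LogConvex) (n : Fin d → ℕ) (c : ℂ) (φ ψ : Space M d) :
    coeff n (c • φ + ψ) = c * coeff n φ + coeff n ψ := by
  have hr : ∀ χ : Space M d, RapidDecay χ.1 := fun χ => by
    obtain ⟨m, χ, rfl⟩ := χ.exists_eq_ofStep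
    exact χ.rapidDecay hM1
  have hn := rapidDecay_hermite n
  have e : (c • φ + ψ).1 = c • φ.1 + ψ.1 := rfl
  rw [coeff, coeff, coeff, e, ← integral_const_mul,
    ← integral_add (((hr φ).integrable_mul' hn).const_mul c) ((hr ψ).integrable_mul' hn)]
  congr 1; funext x
  simp only [Pi.add_apply, Pi.smul_apply, smul_eq_mul]
  ring

theorem coeff_hermite (n k : Fin d → ℕ) (h : hermite k ∈ spaceSubmodule M d) :
    coeff n (⟨hermite k, h⟩ : Space M d) = if k = n then 1 else 0 := integral_hermite_mul k n

theorem UltrafastGrowth.exists_norm_mul_coeff_le (hM1 : M.LogConvex) (hM2 : M.Separative)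
    (hM3 : M.NonTrivial) {b : (Fin d → ℕ) → ℂ} (hb : UltrafastGrowth M b) (m : {r : ℝ // 0 < r}) :
    ∃ u : (Fin d → ℕ) → ℝ, Summable u ∧ ∀ (φ : StepSpace M d m) n,
      ‖b n * coeff n (Space.ofStep m φ)‖ ≤ u n * ‖φ‖ := by
  obtain ⟨θ, C, hθ, hC, hdecay⟩ := StepSpace.exists_norm_integral_le hM1 hM2 hM3 d m
  obtain ⟨θ', hθ', hsum⟩ := exists_summable_exp_assoc hM2 hM3 d hθ
  obtain ⟨C₁, hC₁, hb'⟩ := hb (fun _ => θ') fun _ => hθ'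
  refine ⟨_, hsum.mul_left (C₁ * C), fun φ n => ?_⟩
  rw [norm_mul, coeff_ofStep]
  calc _ ≤ C₁ * Real.exp (∑ i, M.assoc (θ' * √(n i))) *
        (C * ‖φ‖ * Real.exp (-∑ i, M.assoc (θ * √(n i)))) :=
        mul_le_mul (hb' n) (hdecay φ n) (norm_nonneg _) (by positivity)
    _ = _ := by ring

theorem UltrafastGrowth.summable_mul_coeff (hM1 : M.LogConvex) (hM2 : M.Separative)
    (hM3 : M.NonTrivial) {b : (Fin d → ℕ) → ℂ} (hb : UltrafastGrowth M b) (φ : Space M d) :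
    Summable fun n => b n * coeff n φ := by
  obtain ⟨m, φ, rfl⟩ := φ.exists_eq_ofStep
  obtain ⟨u, hu, h⟩ := hb.exists_norm_mul_coeff_le hM1 hM2 hM3 m
  exact Summable.of_norm_bounded (hu.mul_right ‖φ‖) fun n => h φ n

/-- The functional `φ ↦ ∑ n, b_n a_n(φ)` defined by a sequence of ultrafast growth, without its
continuity. -/
def UltrafastGrowth.linearFunctional (hM1 : M.LogConvex) (hM2 : M.Separative)
    (hM3 : M.NonTrivial) {b : (Fin d → ℕ) → ℂ} (hb : UltrafastGrowth M b) : Space M d →ₗ[ℂ] ℂ where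
  toFun φ := ∑' n, b n * coeff n φ
  map_add' φ ψ := by
    rw [← (hb.summable_mul_coeff hM1 hM2 hM3 φ).tsum_add (hb.summable_mul_coeff hM1 hM2 hM3 ψ)]
    refine tsum_congr fun n => ?_
    have := coeff_linear hM1 n 1 φ ψ
    rw [one_smul, one_mul] at this
    rw [this, mul_add]
  map_smul' c φ := by
    rw [RingHom.id_apply, smul_eq_mul, ← tsum_mul_left]
    refine tsum_congr fun n => ?_
    have h0 : coeff n (0 : Space M d) = 0 := by
      simpa using coeff_linear hM1 n 1 (0 : Space M d) 0
    have := coeff_linear hM1 n c φ 0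
    rw [add_zero, h0, add_zero] at this
    rw [this, mul_left_comm]

/-- The functional `φ ↦ ∑ n, b_n a_n(φ)` defined by a sequence of ultrafast growth. -/
def UltrafastGrowth.functional (hM1 : M.LogConvex) (hM2 : M.Separative)
    (hM3 : M.NonTrivial) {b : (Fin d → ℕ) → ℂ} (hb : UltrafastGrowth M b) : Space M d →L[ℂ] ℂ :=
  ⟨hb.linearFunctional hM1 hM2 hM3, by
    refine Space.continuous_of_comp_ofStep _ fun m => ?_
    obtain ⟨u, hu, h⟩ := hb.exists_norm_mul_coeff_le hM1 hM2 hM3 m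
    refine AddMonoidHomClass.continuous_of_bound
      ((hb.linearFunctional hM1 hM2 hM3).comp (Space.ofStep m)) (∑' n, u n) fun φ => ?_
    exact tsum_of_norm_bounded (hu.hasSum.mul_right ‖φ‖) fun n => h φ n⟩

theorem UltrafastGrowth.hasSum_functional (hM1 : M.LogConvex) (hM2 : M.Separative)
    (hM3 : M.NonTrivial) {b : (Fin d → ℕ) → ℂ} (hb : UltrafastGrowth M b) (φ : Space M d) :
    HasSum (fun n => b n * coeff n φ) (hb.functional hM1 hM2 hM3 φ) :=
  (hb.summable_mul_coeff hM1 hM2 hM3 φ).hasSum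

theorem hasSum_apply_hermite_mul_coeff (hM1 : M.LogConvex) (hM2 : M.Separative)
    (hM3 : M.NonTrivial) (hH : ∀ n : Fin d → ℕ, hermite n ∈ spaceSubmodule M d)
    (f : Space M d →L[ℂ] ℂ) (φ : Space M d) :
    HasSum (fun n => f ⟨hermite n, hH n⟩ * coeff n φ) (f φ) := by
  obtain ⟨m, φ, rfl⟩ := φ.exists_eq_ofStep
  obtain ⟨m', hφ, hH', h⟩ := exists_hasSum_hermite hM1 hM2 hM3 φ
  refine ((Space.restrict f m').hasSum h).congr_fun fun n => ?_
  rw [map_smul, smul_eq_mul, mul_comm]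
  rfl

theorem ultrafastGrowth_apply_hermite (hM1 : M.LogConvex) (hM2 : M.Separative)
    (hM3 : M.NonTrivial) (hH : ∀ n : Fin d → ℕ, hermite n ∈ spaceSubmodule M d)
    (f : Space M d →L[ℂ] ℂ) : UltrafastGrowth M fun n => f ⟨hermite n, hH n⟩ := by
  intro θ hθ
  have hs : 0 ≤ ∑ k, (θ k)⁻¹ := Finset.sum_nonneg fun k _ => (inv_pos.2 (hθ k)).le
  -- a positive lower bound of all `θ k`, also for `d = 0`
  set θ₀ : ℝ := (1 + ∑ k, (θ k)⁻¹)⁻¹ with hθ₀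
  have hθ₀0 : 0 < θ₀ := by positivity
  have hle : ∀ k, θ₀ ≤ θ k := fun k => by
    refine inv_le_of_inv_le₀ (hθ k) ?_
    have := Finset.single_le_sum (fun k _ => (inv_pos.2 (hθ k)).le) (Finset.mem_univ k)
    linarith
  obtain ⟨m, C, hC, h⟩ := exists_hermite_mem_stepSubmodule hM1 hM2 hM3 d hθ₀0
  refine ⟨(‖Space.restrict f m‖ + 1) * C, by positivity, fun n => ?_⟩
  obtain ⟨hn, hnorm⟩ := h m le_rfl n
  have hexp : Real.exp (∑ i, M.assoc (θ₀ * √(n i))) ≤ Real.exp (∑ i, M.assoc (θ i * √(n i))) := by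
    rw [Real.exp_sum, Real.exp_sum]
    refine Finset.prod_le_prod (fun i _ => (Real.exp_pos _).le) fun i _ => ?_
    exact M.exp_assoc_mono hM3 (by positivity) (by gcongr; exact hle i)
  calc ‖f ⟨hermite n, hH n⟩‖ = ‖Space.restrict f m (StepSpace.mk (hermite n) hn)‖ := rfl
    _ ≤ ‖Space.restrict f m‖ * ‖StepSpace.mk (hermite n) hn‖ :=
      ContinuousLinearMap.le_opNorm _ _
    _ ≤ (‖Space.restrict f m‖ + 1) * (C * Real.exp (∑ i, M.assoc (θ i * √(n i)))) := by
      gcongr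
      · linarith
      · exact hnorm.trans (by gcongr)
    _ = _ := by ring

end Expansion

end GelfandShilov

end

open GelfandShilov in
/-- The Hermite functions lie in the Gelfand-Shilov space, so `a_n(f) = ⟨f, H_n⟩` makes sense, and
(1) Hermite coefficients of elements of the dual have ultrafast growth and represent the functional;
(2) each sequence of ultrafast growth comes from exactly one element of the dual. -/
theorem theorem2p2 (M : WeightSequence) (hM1 : M.LogConvex) (hM2 : M.Separative)
    (hM3 : M.NonTrivial) (d : ℕ) :
    ∃ hH : ∀ n : Fin d → ℕ, hermite n ∈ spaceSubmodule M d,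
      (∀ f : Space M d →L[ℂ] ℂ,
        UltrafastGrowth M (fun n => f ⟨hermite n, hH n⟩) ∧
        ∀ φ : Space M d, HasSum (fun n => f ⟨hermite n, hH n⟩ * coeff n φ) (f φ)) ∧
      (∀ b : (Fin d → ℕ) → ℂ, UltrafastGrowth M b →
        ∃ f : Space M d →L[ℂ] ℂ,
          (∀ n, f ⟨hermite n, hH n⟩ = b n) ∧
          (∀ φ : Space M d, HasSum (fun n => f ⟨hermite n, hH n⟩ * coeff n φ) (f φ)) ∧
          ∀ g : Space M d →L[ℂ] ℂ, (∀ n, g ⟨hermite n, hH n⟩ = b n) → g = f) := by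
  obtain ⟨m, _, _, hmem⟩ := exists_hermite_mem_stepSubmodule hM1 hM2 hM3 d one_pos
  have hH : ∀ n : Fin d → ℕ, hermite n ∈ spaceSubmodule M d :=
    fun n => ⟨m, (hmem m le_rfl n).choose⟩
  have hexpand := hasSum_apply_hermite_mul_coeff hM1 hM2 hM3 hH
  refine ⟨hH, fun f => ⟨ultrafastGrowth_apply_hermite hM1 hM2 hM3 hH f, hexpand f⟩,
    fun b hb => ⟨hb.functional hM1 hM2 hM3, fun n => ?_, hexpand _, fun g hg => ?_⟩⟩
  · have h := hb.hasSum_functional hM1 hM2 hM3 ⟨hermite n, hH n⟩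
    simp only [coeff_hermite] at h
    refine h.unique ?_
    have := hasSum_single (f := fun k => b k * if n = k then 1 else 0) n
      fun k hk => by simp [hk.symm]
    simpa using this
  · refine ContinuousLinearMap.ext fun φ => ?_
    have h := hexpand g φ
    simp only [hg] at h
    exact h.unique (hb.hasSum_functional hM1 hM2 hM3 φ)
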